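/- Let $m\ge 1$. There exist constants $A_m,B_m,C_m>0$, depending only on $m$, such that the following holds. Let $(\mathbb H,\langle\cdot,\cdot\rangle)$ be a separable Hilbert space, let $(\xi_i)_{i\ge1}$ be an i.i.d. sequence of random variables with values in a measurable space $(S,\mathcal S)$, and let $h\colon S^m\to\mathbb H$ be measurable, symmetric (invariant under all permutations of its $m$ arguments) and such that $\mathbb E\|h(\xi_1,\dots,\xi_m)\|_{\mathbb H}<\infty$. For $0\le k\le m$ put $$h_k(s_1,\dots,s_k)=\sum_{j=0}^k(-1)^{k-j}\sum_{1\le u_1<\dots<u_j\le k}\mathbb E\big[h(s_{u_1},\dots,s_{u_j},\xi_{j+1},\dots,\xi_m)\big]$$ (so that $h_0=\mathbb E[h(\xi_1,\dots,\xi_m)]$), and for a kernel $g\colon S^k\to\mathbb H$ put $$U_{k,n}(g)=\sum_{1\le i_1<\dots<i_k\le n}g(\xi_{i_1},\dots,\xi_{i_k}).$$ Let $1\le d\le m$ and assume that $h$ is degenerate of order $d$, that is, for each $k\in\{0,\dots,d-1\}$ and each $n$, $U_{k,n}(h_k)=0$ almost surely. Then for all $N\ge m$ and all $x,y>0$, $$\mathbb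 P\Big(\max_{m\le n\le N}\|U_{m,n}(h)\|_{\mathbb H}>xN^{m-\frac d2}\Big)\le A_m\exp\Big(-\Big(\frac xy\Big)^{\frac2d}\Big)+B_m\sum_{k=d}^m\int_1^\infty\mathbb P\Big(H_k>C_m\,u\,N^{\frac{k-d}2}x^{1-\frac kd}y^{\frac kd}\Big)\,u\,(1+\log u)^{\frac{m(m+1)}2}\,du,$$ where $H_k=\mathbb E\big[\|h(\xi_1,\dots,\xi_m)\|_{\mathbb H}\,\big|\,\xi_1,\dots,\xi_k\big]$ and the right-hand side may be $+\infty$. -/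

import Mathlib

open MeasureTheory ProbabilityTheory

namespace UStat

noncomputable section

/-- The strictly increasing `m`-tuples of indices taken among the first `n` indices
(indices are `0, …, n - 1` in place of `1, …, n`). -/
def Inc (m n : ℕ) : Finset (Fin m → Fin n) :=
  open Classical in Finset.univ.filter fun i => StrictMono i

variable {Ω S H : Type*}

/-- The first `k` terms of the sequence `ξ`, as a random vector. -/
def initial (ξ : ℕ → Ω → S) (k : ℕ) (ω : Ω) : Fin k → S := fun l => ξ l ω

/-- The `U`-statistic `U_{m,n}(h)`: the sum of `h (ξ_{i_1}, …, ξ_{i_m})` over all increasing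
`m`-tuples of indices among the first `n` ones. -/
def uStat [AddCommMonoid H] (ξ : ℕ → Ω → S) {m : ℕ} (h : (Fin m → S) → H) (n : ℕ) (ω : Ω) : H :=
  ∑ i ∈ Inc m n, h fun l => ξ (i l) ω

/-- A kernel is symmetric if it is invariant under all permutations of its arguments. -/
def IsSymmetric {m : ℕ} (h : (Fin m → S) → H) : Prop :=
  ∀ (σ : Equiv.Perm (Fin m)) (s : Fin m → S), h (fun l => s (σ l)) = h s

/-- The kernel `h_k` (for `k ≤ m`) of the Hoeffding decomposition,
`h_k (s_1, …, s_k) = ∑_{j = 0}^k (-1)^{k - j} ∑_{1 ≤ u_1 < ⋯ < u_j ≤ k}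
  𝔼[h (s_{u_1}, …, s_{u_j}, ξ_{j + 1}, …, ξ_m)]`; for `k = 0` it is the constant
`𝔼[h (ξ_1, …, ξ_m)]`. -/
def hoeffdingKernel [NormedAddCommGroup H] [NormedSpace ℝ H] [MeasurableSpace Ω]
    (μ : Measure Ω) (ξ : ℕ → Ω → S) {m : ℕ} (h : (Fin m → S) → H) (k : ℕ) (s : Fin k → S) : H :=
  ∑ j ∈ Finset.range (k + 1), (-1 : ℝ) ^ (k - j) • ∑ u ∈ Inc j k,
    ∫ ω, h (fun l : Fin m => if hl : (l : ℕ) < j then s (u ⟨l, hl⟩) else ξ l ω) ∂μ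

/-- The kernel `h` is degenerate of order `d` if, for all `k < d`, the `U`-statistics with kernel
`h_k` vanish almost surely. -/
def IsDegenerateOfOrder [NormedAddCommGroup H] [NormedSpace ℝ H] [MeasurableSpace Ω]
    (μ : Measure Ω) (ξ : ℕ → Ω → S) {m : ℕ} (h : (Fin m → S) → H) (d : ℕ) : Prop :=
  ∀ k < d, ∀ n : ℕ, ∀ᵐ ω ∂μ, uStat ξ (hoeffdingKernel μ ξ h k) n ω = 0

/-- The random variable `H_k = 𝔼[‖h (ξ_1, …, ξ_m)‖ ∣ ξ_1, …, ξ_k]`. -/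
def condNorm [NormedAddCommGroup H] [MeasurableSpace Ω] [MeasurableSpace S]
    (μ : Measure Ω) (ξ : ℕ → Ω → S) {m : ℕ} (h : (Fin m → S) → H) (k : ℕ) : Ω → ℝ :=
  μ[fun ω => ‖h (initial ξ m ω)‖ | MeasurableSpace.comap (initial ξ k) MeasurableSpace.pi]

end

end UStat

/-! ### Increasing tuples and the pointwise Hoeffding decomposition -/

namespace UStat

/-! Hoeffding's decomposition writes U_{m,n}(h) as the sum over k ≤ m of C(n-k, m-k) U_{k,n}(h_k)
(`uStat_eq_sum_choose_smul`), and degeneracy removes the terms with k < d. For k ≤ m, h_k agrees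
almost everywhere with the projection `canonicalPart` of the mean of h given its first k arguments,
so integrating out any one variable gives zero. It is therefore enough to bound the maximum of each
U_{k,n}(h_k), with levels chosen so that every k produces the same exponential term
(`ae_norm_uStat_le_sum`, `measure_uStat_canonicalPart_le`).

For a canonical kernel r, E‖U_{k,n}(r)‖^{2q} ≤ (8qn)^{kq} E‖r‖^{2q}
(`integral_norm_tupleStat_pow_le`). The source is a Hilbert space inequality, `norm_add_pow_le`,
bounding ‖a+b‖^{2q} by (‖a‖² + 8q‖b‖²)^q plus a term linear in b. A new observation increments the
statistic by a b of conditional mean zero, so the linear term integrates to zero. The 2q-th powers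
also form a submartingale, and Doob's inequality transfers the bound to the maximum over n.

For the tail, the kernel is truncated at a multiple of y and both pieces are projected again. On the
bounded piece, q close to (x/y)^{2/k} turns Markov's inequality into exp(-(x/y)^{2/k}). On the
unbounded piece, q = 1 suffices, and its second moment is dominated by an integral of the tail of
the kernel, hence of H_k. No logarithm is lost, so the logarithmic weight in the statement only adds
room. -/

lemma mem_Inc {m n : ℕ} {i : Fin m → Fin n} : i ∈ Inc m n ↔ StrictMono i := by
  simp [Inc]

/-- Sums over increasing tuples are sums over subsets. -/
lemma sum_Inc_eq_sum_powersetCard {M : Type*} [AddCommMonoid M] {k n : ℕ}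
    (G : Finset (Fin n) → M) :
    ∑ w ∈ Inc k n, G (Finset.univ.image w) = ∑ V ∈ Finset.univ.powersetCard k, G V := by
  refine Finset.sum_bij (fun w _ => Finset.univ.image w) ?_ ?_ ?_ (fun _ _ => rfl)
  · intro w hw
    simp [Finset.mem_powersetCard, Finset.card_image_of_injective _ (mem_Inc.1 hw).injective]
  · intro v hv w hw hvw
    have hcard : (Finset.univ.image w).card = k := by
      simp [Finset.card_image_of_injective _ (mem_Inc.1 hw).injective]
    exact (Finset.orderEmbOfFin_unique hcard (f := v) (fun x => by rw [← hvw]; simp)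
      (mem_Inc.1 hv)).trans (Finset.orderEmbOfFin_unique hcard (f := w) (fun x => by simp)
      (mem_Inc.1 hw)).symm
  · intro V hV
    have hcard := (Finset.mem_powersetCard.1 hV).2
    exact ⟨V.orderEmbOfFin hcard, mem_Inc.2 (V.orderEmbOfFin hcard).strictMono, by simp⟩

/-- Double counting: a k-subset of n indices lies in exactly C(n-k, m-k) subsets of size m. -/
lemma sum_Inc_comp {M : Type*} [AddCommMonoid M] {k m n : ℕ} (hkm : k ≤ m)
    (G : (Fin k → Fin n) → M) :
    ∑ I ∈ Inc m n, ∑ w ∈ Inc k m, G (I ∘ w) = (n - k).choose (m - k) • ∑ v ∈ Inc k n, G v := by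
  classical
  -- An increasing tuple is determined by its image, so `G` becomes a function of subsets; the
  -- default 0 is never evaluated, as only k-subsets occur.
  set F : Finset (Fin n) → M := fun V =>
    if hV : V.card = k then G (V.orderEmbOfFin hV) else 0 with hF
  have hGF : ∀ v : Fin k → Fin n, StrictMono v → G v = F (Finset.univ.image v) := by
    intro v hv
    have hcard : (Finset.univ.image v).card = k := by
      simp [Finset.card_image_of_injective _ hv.injective]
    rw [hF]
    simp only [hcard, dif_pos]
    rw [← Finset.orderEmbOfFin_unique hcard (f := v) (fun x => by simp) hv]
  have h1 : ∀ I ∈ Inc m n, ∑ w ∈ Inc k m, G (I ∘ w) =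
      ∑ V ∈ (Finset.univ.image I).powersetCard k, F V := by
    intro I hI
    have hI := mem_Inc.1 hI
    have e : Finset.univ.image I = Finset.univ.map ⟨I, hI.injective⟩ := by
      ext; simp
    rw [e, Finset.powersetCard_map, Finset.sum_map, ← sum_Inc_eq_sum_powersetCard]
    refine Finset.sum_congr rfl fun w hw => ?_
    rw [hGF _ (hI.comp (mem_Inc.1 hw))]
    congr 1
    ext; simp
  rw [Finset.sum_congr rfl h1, sum_Inc_eq_sum_powersetCard
      (fun T => ∑ V ∈ T.powersetCard k, F V),
    Finset.sum_congr rfl fun v hv => hGF v (mem_Inc.1 hv), sum_Inc_eq_sum_powersetCard,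
    Finset.smul_sum, Finset.sum_comm' (t' := Finset.univ.powersetCard k)
      (s' := fun V => (Finset.univ.powersetCard m).filter (V ⊆ ·))]
  · refine Finset.sum_congr rfl fun V hV => ?_
    have hcard := (Finset.mem_powersetCard.1 hV).2
    rw [Finset.sum_const, Finset.card_filter_powersetCard_subset]
    all_goals simp [hcard, hkm]
  · intro T V
    simp only [Finset.mem_powersetCard, Finset.mem_filter]
    simp
    tauto

/-- The pointwise Hoeffding decomposition. -/
lemma uStat_eq_sum_choose_smul {Ω S H : Type*} [AddCommGroup H] [Module ℝ H]
    {m n : ℕ} (hmn : m ≤ n) (e : (j : ℕ) → (Fin j → S) → H) (ξ : ℕ → Ω → S) (ω : Ω) :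
    uStat ξ (e m) n ω = ∑ k ∈ Finset.range (m + 1), ((n - k).choose (m - k) : ℝ) •
      uStat ξ (fun s : Fin k → S => ∑ j ∈ Finset.range (k + 1), (-1 : ℝ) ^ (k - j) •
        ∑ u ∈ Inc j k, e j (s ∘ u)) n ω := by
  have h1 : ∀ k ∈ Finset.range (m + 1), ((n - k).choose (m - k) : ℝ) •
      uStat ξ (fun s : Fin k → S => ∑ j ∈ Finset.range (k + 1), (-1 : ℝ) ^ (k - j) •
        ∑ u ∈ Inc j k, e j (s ∘ u)) n ω =
      ∑ j ∈ Finset.range (k + 1), (((n - k).choose (m - k) : ℝ) * ((-1 : ℝ) ^ (k - j) *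
        ((n - j).choose (k - j) : ℝ))) • uStat ξ (e j) n ω := by
    intro k hk
    unfold uStat
    rw [Finset.sum_comm, Finset.smul_sum]
    refine Finset.sum_congr rfl fun j hj => ?_
    rw [← Finset.smul_sum]
    have := sum_Inc_comp (n := n) (Nat.lt_succ_iff.1 (Finset.mem_range.1 hj))
      (fun v => e j fun l => ξ (v l) ω)
    rw [mul_smul, mul_smul, Nat.cast_smul_eq_nsmul ℝ ((n - j).choose (k - j)), ← this]
    rfl
  rw [Finset.sum_congr rfl h1, Finset.sum_comm' (t' := Finset.range (m + 1))
    (s' := fun j => Finset.Icc j m) (by intro k j; simp; omega)]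
  simp_rw [← Finset.sum_smul]
  -- Since C(n-k, m-k) C(n-j, k-j) = C(n-j, m-j) C(m-j, k-j), the coefficient of the statistic of `e
  -- j` is C(n-j, m-j) times the binomial expansion of (1-1)^{m-j}, so only j = m survives.
  have h2 : ∀ j ∈ Finset.range (m + 1), (∑ k ∈ Finset.Icc j m, ((n - k).choose (m - k) : ℝ) *
      ((-1 : ℝ) ^ (k - j) * ((n - j).choose (k - j) : ℝ))) = if j = m then 1 else 0 := by
    intro j hj
    have hjm := Nat.lt_succ_iff.1 (Finset.mem_range.1 hj)
    have h3 : ∀ k ∈ Finset.Icc j m, ((n - k).choose (m - k) : ℝ) *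
        ((-1 : ℝ) ^ (k - j) * ((n - j).choose (k - j) : ℝ)) =
        (n - j).choose (m - j) * ((-1 : ℝ) ^ (k - j) * ((m - j).choose (k - j) : ℝ)) := by
      intro k hk
      obtain ⟨hjk, hkm⟩ := Finset.mem_Icc.1 hk
      have := Nat.choose_mul (n := n - j) (k := m - j) (s := k - j) (by omega)
      rw [show n - j - (k - j) = n - k by omega, show m - j - (k - j) = m - k by omega] at this
      have h : ((n - j).choose (m - j) : ℝ) * ((m - j).choose (k - j)) =
        (n - j).choose (k - j) * (n - k).choose (m - k) := by exact_mod_cast this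
      linear_combination (-1 : ℝ) ^ (k - j) * (-h)
    rw [Finset.sum_congr rfl h3, ← Finset.mul_sum]
    have h4 : ∑ k ∈ Finset.Icc j m, (-1 : ℝ) ^ (k - j) * ((m - j).choose (k - j) : ℝ) =
        ∑ i ∈ Finset.range (m - j + 1), (-1 : ℝ) ^ i * ((m - j).choose i : ℝ) := by
      refine Finset.sum_bij' (fun k _ => k - j) (fun i _ => i + j) ?_ ?_ ?_ ?_ ?_ <;>
        intros <;> (simp_all; try omega)
    have h5 := Int.alternating_sum_range_choose (n := m - j)
    have h6 : ∑ i ∈ Finset.range (m - j + 1), (-1 : ℝ) ^ i * ((m - j).choose i : ℝ) =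
        if m - j = 0 then 1 else 0 := by exact_mod_cast h5
    rw [h4, h6]
    by_cases h : j = m
    · simp [h]
    · simp [h, show m - j ≠ 0 by omega]
  rw [Finset.sum_congr rfl fun j hj => by rw [h2 j hj]]
  simp

/-- The law of a vector of independent random variables with common law `P`. -/
noncomputable abbrev powMeasure {S : Type*} [MeasurableSpace S] (P : Measure S) (ι : Type*) [Fintype ι] : Measure (ι → S) :=
  Measure.pi fun _ => P

/-! ### Coordinate selections preserving product measures -/

section Measure
variable {S : Type*} [MeasurableSpace S] (P : Measure S) [IsProbabilityMeasure P]

/-- Selecting distinct coordinates preserves the product measure. -/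
lemma measurePreserving_precomp {ι κ : Type*} [Fintype ι] [Fintype κ] {φ : κ → ι}
    (hφ : φ.Injective) :
    MeasurePreserving (fun s : ι → S => s ∘ φ) (powMeasure P ι) (powMeasure P κ) := by
  have hm : Measurable fun s : ι → S => s ∘ φ :=
    measurable_pi_lambda _ fun i => measurable_pi_apply _
  refine ⟨hm, ?_⟩
  have h := (iIndepFun_pi (μ := fun _ : ι => P) (X := fun _ => (id : S → S))
    (fun _ => aemeasurable_id)).precomp hφ
  have h2 := h.map_fun_eq_pi_map (fun i => (measurable_pi_apply _).aemeasurable)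
  refine Eq.trans h2 ?_
  congr 1
  funext i
  exact (measurePreserving_eval (fun _ : ι => P) (φ i)).map_eq

/-- Common source of the merge, glue and update maps: each picks distinct coordinates out of two
independent samples. -/
lemma measurePreserving_sumElim_comp {ι ι' κ : Type*} [Fintype ι] [Fintype ι'] [Fintype κ] {φ : κ → ι ⊕ ι'}
    (hφ : φ.Injective) :
    MeasurePreserving (fun p : (ι → S) × (ι' → S) => Sum.elim p.1 p.2 ∘ φ)
      ((powMeasure P ι).prod (powMeasure P ι')) (powMeasure P κ) := by
  have h := measurePreserving_sumPiEquivProdPi_symm (X := fun _ : ι ⊕ ι' => S) (fun _ => P)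
  refine (measurePreserving_precomp P hφ).comp (g := fun s => s ∘ φ)  ?_
  convert h using 1
  funext p i
  rcases i with i | i <;> rfl

/-- The vector with coordinates taken from `s` on `w` and from `t` elsewhere. -/
def merge {ι : Type*} [DecidableEq ι] (w : Finset ι) (s t : ι → S) : ι → S :=
  fun i => if i ∈ w then s i else t i

lemma measurePreserving_merge {ι : Type*} [Fintype ι] [DecidableEq ι] (w : Finset ι) :
    MeasurePreserving (fun p : (ι → S) × (ι → S) => merge w p.1 p.2)
      ((powMeasure P ι).prod (powMeasure P ι)) (powMeasure P ι) := by
  have := measurePreserving_sumElim_comp P (ι := ι) (ι' := ι)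
    (φ := fun i => if i ∈ w then Sum.inl i else Sum.inr i) (by
      intro i j; simp only; split_ifs <;> simp)
  convert this using 1
  funext p i
  simp only [merge, Function.comp]
  split_ifs <;> rfl

/-- The `m`-vector whose first coordinates are those of `s`, completed with those of `t`. -/
def glue {k m : ℕ} (s : Fin k → S) (t : Fin m → S) : Fin m → S :=
  fun l => if hl : (l : ℕ) < k then s ⟨l, hl⟩ else t l

lemma measurePreserving_glue {k m : ℕ} :
    MeasurePreserving (fun p : (Fin k → S) × (Fin m → S) => glue p.1 p.2)
      ((powMeasure P (Fin k)).prod (powMeasure P (Fin m))) (powMeasure P (Fin m)) := by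
  have := measurePreserving_sumElim_comp P (ι := Fin k) (ι' := Fin m)
    (φ := fun l : Fin m => if hl : (l : ℕ) < k then Sum.inl ⟨l, hl⟩ else Sum.inr l) (by
      intro i j; simp only; split_ifs <;> simp [Fin.ext_iff])
  convert this using 1
  funext p i
  simp only [glue, Function.comp]
  split_ifs <;> rfl

lemma measurePreserving_snoc {n : ℕ} :
    MeasurePreserving (fun p : S × (Fin n → S) => (Fin.snoc p.2 p.1 : Fin (n + 1) → S))
      (P.prod (powMeasure P (Fin n))) (powMeasure P (Fin (n + 1))) := by
  have h := (measurePreserving_piFinSuccAbove (α := fun _ => S) (fun _ => P) (Fin.last n)).symm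
  convert h using 1
  funext p
  rw [← Fin.insertNth_last']
  rfl

lemma measurePreserving_update {ι : Type*} [Fintype ι] [DecidableEq ι] (i : ι) :
    MeasurePreserving (fun p : (ι → S) × S => Function.update p.1 i p.2)
      ((powMeasure P ι).prod P) (powMeasure P ι) := by
  have h1 := measurePreserving_sumElim_comp P (ι := ι) (ι' := Unit)
    (φ := fun j => if j = i then Sum.inr () else Sum.inl j) (by
      intro j k; simp only; split_ifs <;> simp_all)
  have h2 := (measurePreserving_funUnique P Unit).symm
  have h3 := h1.comp ((MeasurePreserving.id (powMeasure P ι)).prod h2)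
  convert h3 using 1
  funext p j
  simp only [Function.update_apply, Function.comp]
  split_ifs <;> rfl

end Measure

/-! ### Hilbert space inequalities for even powers of the norm -/

/-- The even part of (A+B)^{2q} and AB times its odd part satisfy a coupled linear recursion in q,
so neither bound can be propagated alone. The first step needs K ≥ 4q + 1, which 4(q+1) ≤ K
provides. -/
lemma even_odd_pow_bound {A B K : ℝ} (q : ℕ) (hK : 4 * (q : ℝ) ≤ K) :
    ((A + B) ^ (2 * q) + (A - B) ^ (2 * q)) / 2 ≤ (A ^ 2 + K * B ^ 2) ^ q ∧
      A * B * (((A + B) ^ (2 * q) - (A - B) ^ (2 * q)) / 2) ≤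
        2 * q * B ^ 2 * (A ^ 2 + K * B ^ 2) ^ q := by
  induction q with
  | zero => simp
  | succ q ih =>
    push_cast at hK
    obtain ⟨h1, h2⟩ := ih (by linarith)
    have hK0 : 0 ≤ K := le_trans (by positivity) hK
    set F := A ^ 2 + K * B ^ 2 with hF
    have hF0 : 0 ≤ F ^ q := by positivity
    have e1 : ((A + B) ^ (2 * (q + 1)) + (A - B) ^ (2 * (q + 1))) / 2 =
        (A ^ 2 + B ^ 2) * (((A + B) ^ (2 * q) + (A - B) ^ (2 * q)) / 2) +
          2 * (A * B * (((A + B) ^ (2 * q) - (A - B) ^ (2 * q)) / 2)) := by ring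
    have e2 : A * B * (((A + B) ^ (2 * (q + 1)) - (A - B) ^ (2 * (q + 1))) / 2) =
        (A ^ 2 + B ^ 2) * (A * B * (((A + B) ^ (2 * q) - (A - B) ^ (2 * q)) / 2)) +
          2 * (A ^ 2 * B ^ 2) * (((A + B) ^ (2 * q) + (A - B) ^ (2 * q)) / 2) := by ring
    rw [e1, e2]
    have hq : (0 : ℝ) ≤ q := q.cast_nonneg
    constructor
    · calc _ ≤ (A ^ 2 + B ^ 2) * F ^ q + 2 * (2 * q * B ^ 2 * F ^ q) := by gcongr
        _ = (A ^ 2 + (1 + 4 * q) * B ^ 2) * F ^ q := by ring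
        _ ≤ F * F ^ q := by rw [hF]; gcongr; linarith
        _ = F ^ (q + 1) := by ring
    · calc _ ≤ (A ^ 2 + B ^ 2) * (2 * q * B ^ 2 * F ^ q) + 2 * (A ^ 2 * B ^ 2) * F ^ q := by gcongr
        _ = (2 * (q + 1) * B ^ 2 * F ^ q) * A ^ 2 + 2 * q * B ^ 2 * F ^ q * B ^ 2 := by ring
        _ ≤ (2 * (q + 1) * B ^ 2 * F ^ q) * A ^ 2 +
              2 * (q + 1) * B ^ 2 * F ^ q * (K * B ^ 2) := by
            gcongr
            · linarith
            · nlinarith [sq_nonneg B]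
        _ = _ := by rw [hF]; push_cast; ring

lemma pow_add_mul_sub_le {X Z : ℝ} (hX : 0 ≤ X) (hZ : 0 ≤ Z) (q : ℕ) :
    X ^ q + q * X ^ (q - 1) * (Z - X) ≤ Z ^ q := by
  rcases Nat.eq_zero_or_pos q with rfl | hq
  · simp
  rcases hX.eq_or_lt with rfl | hX
  · rcases Nat.lt_or_ge 1 q with h | h
    · simp [Nat.sub_ne_zero_of_lt h, hq.ne']
      positivity
    · obtain rfl : q = 1 := by omega
      simp
  · have h := one_add_mul_le_pow (a := (Z - X) / X) (by
      rw [le_div_iff₀ hX]; linarith) q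
    have e : 1 + (Z - X) / X = Z / X := by field_simp; ring
    rw [e, div_pow, le_div_iff₀ (by positivity)] at h
    obtain ⟨p, rfl⟩ : ∃ p, q = p + 1 := ⟨q - 1, by omega⟩
    simp only [Nat.add_sub_cancel]
    refine le_trans (le_of_eq ?_) h
    field_simp
    ring

section Hilbert
variable {H : Type*} [NormedAddCommGroup H] [InnerProductSpace ℝ H]

/-- Convexity bound behind the submartingale property: the inner product term will have zero
integral over past events. -/
lemma norm_pow_add_inner_le (a b : H) (q : ℕ) :
    ‖a‖ ^ (2 * q) + 2 * q * (‖a‖ ^ (2 * (q - 1)) * inner ℝ a b) ≤ ‖a + b‖ ^ (2 * q) := by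
  have h := pow_add_mul_sub_le (sq_nonneg ‖a‖) (sq_nonneg ‖a + b‖) q
  simp only [← pow_mul] at h
  refine le_trans ?_ h
  have e : ‖a + b‖ ^ 2 - ‖a‖ ^ 2 = 2 * inner ℝ a b + ‖b‖ ^ 2 := by
    rw [norm_add_sq_real]; ring
  rw [e]
  have : 0 ≤ (q : ℝ) * ‖a‖ ^ (2 * (q - 1)) * ‖b‖ ^ 2 := by positivity
  linarith

/-- Writing the inner product as tAB with |t| ≤ 1 makes ‖a+b‖² a convex combination of (A+B)² and
(A-B)², which reduces the claim to scalars. The growth of 8q only linearly in q is what later yields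
the exponent 2/k. -/
lemma norm_add_pow_le (a b : H) (q : ℕ) :
    ‖a + b‖ ^ (2 * q) ≤ (‖a‖ ^ 2 + 8 * q * ‖b‖ ^ 2) ^ q +
      2 * q * (‖a‖ ^ (2 * (q - 1)) * inner ℝ a b) := by
  rcases Nat.eq_zero_or_pos q with rfl | hq
  · simp
  set A := ‖a‖ with hA
  set B := ‖b‖ with hB
  set u : ℝ := inner ℝ a b with hu
  have hA0 : 0 ≤ A := norm_nonneg _
  have hB0 : 0 ≤ B := norm_nonneg _
  have huAB : |u| ≤ A * B := abs_real_inner_le_norm a b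
  obtain ⟨t, ht, hut⟩ : ∃ t : ℝ, |t| ≤ 1 ∧ u = t * (A * B) := by
    rcases (mul_nonneg hA0 hB0).eq_or_lt with h | h
    · refine ⟨0, by simp, ?_⟩
      rw [← h] at huAB ⊢
      simpa using abs_nonpos_iff.1 huAB
    · refine ⟨u / (A * B), ?_, (div_mul_cancel₀ _ h.ne').symm⟩
      rw [abs_div, abs_of_pos h, div_le_one h]; exact huAB
  obtain ⟨ht1, ht2⟩ := abs_le.1 ht
  have e : ‖a + b‖ ^ (2 * q) =
      ((1 + t) / 2 * (A + B) ^ 2 + (1 - t) / 2 * (A - B) ^ 2) ^ q := by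
    rw [pow_mul, norm_add_sq_real, ← hu, hut]; congr 1; ring
  have hconv := (convexOn_pow (𝕜 := ℝ) q).2
  have h1 := hconv (Set.mem_Ici.2 (sq_nonneg (A + B))) (Set.mem_Ici.2 (sq_nonneg (A - B)))
    (a := (1 + t) / 2) (b := (1 - t) / 2) (by linarith) (by linarith) (by ring)
  have h2 := hconv (Set.mem_Ici.2 (sq_nonneg A))
    (Set.mem_Ici.2 (show 0 ≤ A ^ 2 + 8 * q * B ^ 2 by positivity))
    (a := 1 / 2) (b := 1 / 2) (by norm_num) (by norm_num) (by norm_num)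
  simp only [smul_eq_mul] at h1 h2
  rw [show 1 / 2 * A ^ 2 + 1 / 2 * (A ^ 2 + 8 * q * B ^ 2) = A ^ 2 + 4 * q * B ^ 2 by ring] at h2
  obtain ⟨hE, -⟩ := even_odd_pow_bound (A := A) (B := B) q le_rfl
  have hP := pow_add_mul_sub_le (sq_nonneg A) (sq_nonneg (A + B)) q
  have hM := pow_add_mul_sub_le (sq_nonneg A) (sq_nonneg (A - B)) q
  rw [e, hut]
  simp only [← pow_mul] at h1 h2 hP hM
  set W := q * A ^ (2 * (q - 1)) * (2 * (A * B)) with hW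
  have hB2 : 0 ≤ q * A ^ (2 * (q - 1)) * B ^ 2 := by positivity
  have hP' : A ^ (2 * q) + W ≤ (A + B) ^ (2 * q) := by
    refine le_trans ?_ hP
    rw [hW]; linarith
  have hM' : A ^ (2 * q) - W ≤ (A - B) ^ (2 * q) := by
    refine le_trans ?_ hM
    rw [hW]; linarith
  have hW' : 2 * q * (A ^ (2 * (q - 1)) * (t * (A * B))) = t * W := by rw [hW]; ring
  rw [hW']
  -- With E and O the even and odd parts of (A+B)^{2q}, the target is E + tO = 2E - (E - tO). The
  -- two tangent bounds give E - tO ≥ A^{2q} - tW, and 2E - A^{2q} ≤ (A² + 8qB²)^q follows from `hE`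
  -- and midpoint convexity `h2`; this doubles 4q to 8q.
  have h3 := mul_le_mul_of_nonneg_left hP' (show 0 ≤ (1 - t) / 2 by linarith)
  have h4 := mul_le_mul_of_nonneg_left hM' (show 0 ≤ (1 + t) / 2 by linarith)
  linarith


end Hilbert

/-! ### Recursion in the sample size -/

section Tuple
variable {S H : Type*}

/-- The `U`-statistic with kernel `r`, as a function of the sample. -/
noncomputable def tupleStat [AddCommMonoid H] {k : ℕ} (r : (Fin k → S) → H) (n : ℕ) (s : Fin n → S) : H :=
  ∑ i ∈ Inc k n, r (s ∘ i)

/-- Increasing tuples split according to whether the last index is the largest one available. -/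
lemma sum_Inc_succ [AddCommMonoid H] {k n : ℕ} (G : (Fin (k + 1) → Fin (n + 1)) → H) :
    ∑ i ∈ Inc (k + 1) (n + 1), G i = ∑ i ∈ Inc (k + 1) n, G (Fin.castSucc ∘ i) +
      ∑ i ∈ Inc k n, G (Fin.snoc (Fin.castSucc ∘ i) (Fin.last n)) := by
  classical
  have hinj1 : Function.Injective fun i : Fin (k + 1) → Fin n => Fin.castSucc ∘ i :=
    fun i j h => (Fin.castSucc_injective n).comp_left h
  have hinj2 : Function.Injective fun i : Fin k → Fin n =>
      (Fin.snoc (Fin.castSucc ∘ i) (Fin.last n) : Fin (k + 1) → Fin (n + 1)) := by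
    intro i j h
    have h' := congrArg Fin.init h
    simp only [Fin.init_snoc] at h'
    exact (Fin.castSucc_injective n).comp_left h'
  have hdisj : Disjoint ((Inc (k + 1) n).map ⟨_, hinj1⟩) ((Inc k n).map ⟨_, hinj2⟩) := by
    rw [Finset.disjoint_left]
    intro i hi hi'
    obtain ⟨j, -, rfl⟩ := Finset.mem_map.1 hi
    obtain ⟨j', -, h⟩ := Finset.mem_map.1 hi'
    have := congrFun h (Fin.last k)
    simp at this
    exact (Fin.castSucc_lt_last _).ne' this
  have hU : Inc (k + 1) (n + 1) =
      ((Inc (k + 1) n).map ⟨_, hinj1⟩).disjUnion ((Inc k n).map ⟨_, hinj2⟩) hdisj := by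
    ext i
    simp only [Finset.mem_disjUnion, Finset.mem_map, mem_Inc, Function.Embedding.coeFn_mk]
    constructor
    · intro hi
      by_cases hl : i (Fin.last k) = Fin.last n
      · right
        have hlt : ∀ l : Fin k, i l.castSucc ≠ Fin.last n := fun l =>
          ((hi (Fin.castSucc_lt_last l)).trans_le (Fin.le_last _)).ne
        refine ⟨fun l => (i l.castSucc).castPred (hlt l), ?_, ?_⟩
        · intro a b hab
          exact Fin.castPred_lt_castPred (hi (Fin.castSucc_lt_castSucc_iff.2 hab)) _
        · funext l
          refine Fin.lastCases ?_ (fun l => ?_) l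
          · simp [hl]
          · simp
      · left
        have hlt : ∀ l : Fin (k + 1), i l ≠ Fin.last n := fun l =>
          ((hi.monotone (Fin.le_last l)).trans_lt (Fin.lt_last_iff_ne_last.2 hl)).ne
        refine ⟨fun l => (i l).castPred (hlt l), ?_, ?_⟩
        · intro a b hab
          exact Fin.castPred_lt_castPred (hi hab) _
        · funext l
          simp
    · rintro (⟨j, hj, rfl⟩ | ⟨j, hj, rfl⟩)
      · exact (Fin.strictMono_castSucc).comp hj
      · intro a b hab
        induction b using Fin.lastCases with
        | last =>
          induction a using Fin.lastCases with
          | last => exact absurd hab (lt_irrefl _)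
          | cast a => simp [Fin.castSucc_lt_last]
        | cast b =>
          induction a using Fin.lastCases with
          | last => exact absurd (hab.trans (Fin.castSucc_lt_last b)) (lt_irrefl _)
          | cast a => simpa using hj (Fin.castSucc_lt_castSucc_iff.1 hab)
  rw [hU, Finset.sum_disjUnion, Finset.sum_map, Finset.sum_map]
  rfl

/-- The increment is a statistic of order one less in the earlier observations, its kernel sliced at
the new one. This allows induction on both the order and the sample size. -/
lemma tupleStat_snoc [AddCommMonoid H] {k n : ℕ} (r : (Fin (k + 1) → S) → H) (s : Fin n → S) (x : S) :
    tupleStat r (n + 1) (Fin.snoc s x) =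
      tupleStat r n s + tupleStat (fun s' => r (Fin.snoc s' x)) n s := by
  unfold tupleStat
  rw [sum_Inc_succ]
  congr 1
  · refine Finset.sum_congr rfl fun i _ => ?_
    congr 1
    funext l
    simp
  · refine Finset.sum_congr rfl fun i _ => ?_
    congr 1
    funext l
    refine Fin.lastCases ?_ (fun l => ?_) l <;> simp

lemma tupleStat_of_lt [AddCommMonoid H] {k n : ℕ} (h : n < k) (r : (Fin k → S) → H) (s : Fin n → S) :
    tupleStat r n s = 0 := by
  refine Finset.sum_eq_zero fun i hi => absurd (Fintype.card_le_of_injective i (mem_Inc.1 hi).injective) ?_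
  simpa using h

lemma tupleStat_zero_left [AddCommMonoid H] (n : ℕ) (r : (Fin 0 → S) → H) (s : Fin n → S) :
    tupleStat r n s = r default := by
  have : Inc 0 n = {default} := by
    ext i
    simp only [mem_Inc, Finset.mem_singleton, Subsingleton.elim i default, iff_true]
    intro a; exact a.elim0
  rw [tupleStat, this, Finset.sum_singleton, Subsingleton.elim (s ∘ default) default]

end Tuple

/-! ### Canonical kernels and their moments -/

section Moments
variable {S : Type*} [MeasurableSpace S] (P : Measure S) [IsProbabilityMeasure P]
variable {H : Type*} [NormedAddCommGroup H] [InnerProductSpace ℝ H]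

/-- A kernel is canonical if integrating out any one of its variables gives zero. -/
def IsCanonical {k : ℕ} (r : (Fin k → S) → H) : Prop :=
  ∀ i, ∀ᵐ s ∂powMeasure P (Fin k), ∫ x, r (Function.update s i x) ∂P = 0

variable {P}

lemma ae_prod_of_ae_pow {n : ℕ} {p : (Fin (n + 1) → S) → Prop}
    (h : ∀ᵐ s ∂powMeasure P (Fin (n + 1)), p s) :
    ∀ᵐ z ∂(P.prod (powMeasure P (Fin n))), p (Fin.snoc z.2 z.1) :=
  (measurePreserving_snoc P).quasiMeasurePreserving.ae h

lemma IsCanonical.ae_slice {k : ℕ} {r : (Fin (k + 1) → S) → H} (h : IsCanonical P r) :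
    ∀ᵐ x ∂P, IsCanonical P fun s => r (Fin.snoc s x) := by
  refine ae_all_iff.2 fun i => ?_
  have := Measure.ae_ae_of_ae_prod (ae_prod_of_ae_pow (h i.castSucc))
  filter_upwards [this] with x hx
  filter_upwards [hx] with s hs
  rw [← hs]
  congr 1
  funext t
  rw [Fin.snoc_update]

lemma IsCanonical.ae_integral_snoc {k : ℕ} {r : (Fin (k + 1) → S) → H} (h : IsCanonical P r) :
    ∀ᵐ s ∂powMeasure P (Fin k), ∫ x, r (Fin.snoc s x) ∂P = 0 := by
  -- The last coordinate is overwritten by the integration variable, so the almost sure statement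
  -- need only be read at one good value of it.
  obtain ⟨x, hx⟩ := (Measure.ae_ae_of_ae_prod (ae_prod_of_ae_pow (h (Fin.last k)))).exists
  filter_upwards [hx] with s hs
  rw [← hs]
  congr 1
  funext t
  rw [Fin.update_snoc_last]

omit [InnerProductSpace ℝ H] in
lemma stronglyMeasurable_tupleStat {k : ℕ} {r : (Fin k → S) → H} (hr : StronglyMeasurable r) (n : ℕ) :
    StronglyMeasurable (tupleStat r n) := by
  refine Finset.stronglyMeasurable_fun_sum _ fun i _ => ?_
  exact hr.comp_measurable (measurable_pi_lambda _ fun l => measurable_pi_apply _)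

lemma memLp_natCast_iff {α E : Type*} [MeasurableSpace α] {μ : Measure α} [NormedAddCommGroup E]
    {f : α → E} (hf : AEStronglyMeasurable f μ) {p : ℕ} (hp : p ≠ 0) :
    Integrable (fun x => ‖f x‖ ^ p) μ ↔ MemLp f p μ := by
  rw [← integrable_norm_rpow_iff hf (by simpa using hp) (by simp)]
  simp

omit [InnerProductSpace ℝ H] in
lemma memLp_tupleStat {k : ℕ} {r : (Fin k → S) → H} {p : ENNReal} (hr : MemLp r p (powMeasure P (Fin k)))
    (n : ℕ) : MemLp (tupleStat r n) p (powMeasure P (Fin n)) := by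
  refine memLp_finsetSum _ fun i hi => ?_
  exact hr.comp_measurePreserving (measurePreserving_precomp P (mem_Inc.1 hi).injective)

lemma measurePreserving_snoc_comp {k n : ℕ} {i : Fin k → Fin n} (hi : i.Injective) :
    MeasurePreserving (fun z : S × (Fin n → S) => (Fin.snoc (z.2 ∘ i) z.1 : Fin (k + 1) → S))
      (P.prod (powMeasure P (Fin n))) (powMeasure P (Fin (k + 1))) :=
  (measurePreserving_snoc P).comp
    ((MeasurePreserving.id P).prod (measurePreserving_precomp P hi))

/-- The larger of ‖V‖ and ‖R‖ absorbs the product: ‖V‖^{2q-1}‖R‖ ≤ ‖V‖^{2q} + ‖R‖^{2q}. -/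
lemma integrable_inner_of_norm_le_pow {α : Type*} [MeasurableSpace α] {μ : Measure α} {V W R : α → H}
    {q : ℕ} (hq : 1 ≤ q) (hW : AEStronglyMeasurable W μ) (hWV : ∀ x, ‖W x‖ ≤ ‖V x‖ ^ (2 * q - 1))
    (hV : MemLp V (2 * q : ℕ) μ) (hR : MemLp R (2 * q : ℕ) μ) :
    Integrable (fun x => inner ℝ (W x) (R x)) μ := by
  have h2q : 2 * q ≠ 0 := by omega
  have h1 := (memLp_natCast_iff hV.1 h2q).2 hV
  have h2 := (memLp_natCast_iff hR.1 h2q).2 hR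
  refine (h1.add h2).mono' (hW.inner hR.1) (Filter.Eventually.of_forall fun x => ?_)
  refine (norm_inner_le_norm _ _).trans ?_
  have h3 : ‖W x‖ * ‖R x‖ ≤ ‖V x‖ ^ (2 * q - 1) * ‖R x‖ :=
    mul_le_mul_of_nonneg_right (hWV x) (norm_nonneg _)
  refine h3.trans ?_
  obtain ⟨p, hp⟩ : ∃ p, 2 * q = p + 1 := ⟨2 * q - 1, by omega⟩
  simp only [Pi.add_apply]
  rw [hp, Nat.add_sub_cancel]
  rcases le_total ‖V x‖ ‖R x‖ with h | h
  · calc ‖V x‖ ^ p * ‖R x‖ ≤ ‖R x‖ ^ p * ‖R x‖ := by gcongr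
      _ ≤ _ := by rw [← pow_succ]; linarith [pow_nonneg (norm_nonneg (V x)) (p + 1)]
  · calc ‖V x‖ ^ p * ‖R x‖ ≤ ‖V x‖ ^ p * ‖V x‖ := by gcongr
      _ ≤ _ := by rw [← pow_succ]; linarith [pow_nonneg (norm_nonneg (R x)) (p + 1)]

end Moments


/-- Convexity with weights n/(n+1) and 1/(n+1), chosen so that X^q ≤ n^q c and Y^q ≤ c give exactly
(n+1)^q c. At n = 0 the division by n is degenerate, whence `h0`. -/
lemma add_pow_le_weighted {X Y : ℝ} (hX : 0 ≤ X) (hY : 0 ≤ Y) (q n : ℕ)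
    (h0 : n = 0 → X = 0) :
    (X + Y) ^ q ≤ (n / (n + 1) * ((n + 1) / n) ^ q) * X ^ q +
      (1 / (n + 1) * (n + 1) ^ q) * Y ^ q := by
  rcases Nat.eq_zero_or_pos n with rfl | hn
  · simp [h0 rfl]
  have hn' : (0 : ℝ) < n := by exact_mod_cast hn
  have hconv := (convexOn_pow (𝕜 := ℝ) q).2
  have h := hconv
    (Set.mem_Ici.2 (show 0 ≤ (n + 1) / n * X by positivity))
    (Set.mem_Ici.2 (show 0 ≤ (n + 1) * Y by positivity))
    (a := n / (n + 1)) (b := 1 / (n + 1)) (by positivity) (by positivity) (by field_simp)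
  simp only [smul_eq_mul] at h
  have e : (n : ℝ) / (n + 1) * ((n + 1) / n * X) + 1 / (n + 1) * ((n + 1) * Y) = X + Y := by
    field_simp
  rw [e] at h
  refine h.trans (le_of_eq ?_)
  rw [mul_pow, mul_pow]; ring

section
variable {S : Type*} [MeasurableSpace S] {P : Measure S} [IsProbabilityMeasure P]
variable {H : Type*} [NormedAddCommGroup H] [InnerProductSpace ℝ H] [CompleteSpace H]

/-- `W` depends on the past only, so the new observation can be integrated out first, giving zero
for a canonical kernel. Leaving `W` general covers its restrictions to past events. -/
lemma integral_inner_tupleStat_eq_zero {k n q : ℕ} (hq : 1 ≤ q) {r : (Fin (k + 1) → S) → H}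
    (hr : MemLp r (2 * q : ℕ) (powMeasure P (Fin (k + 1)))) (hdeg : IsCanonical P r)
    {V W : (Fin n → S) → H} (hV : MemLp V (2 * q : ℕ) (powMeasure P (Fin n)))
    (hW : StronglyMeasurable W) (hWV : ∀ x, ‖W x‖ ≤ ‖V x‖ ^ (2 * q - 1)) :
    Integrable (fun z : S × (Fin n → S) =>
        inner ℝ (W z.2) (tupleStat (fun s => r (Fin.snoc s z.1)) n z.2))
      (P.prod (powMeasure P (Fin n))) ∧
    ∫ z : S × (Fin n → S), inner ℝ (W z.2) (tupleStat (fun s => r (Fin.snoc s z.1)) n z.2)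
      ∂(P.prod (powMeasure P (Fin n))) = 0 := by
  have hint : ∀ i ∈ Inc k n, Integrable (fun z : S × (Fin n → S) =>
      inner ℝ (W z.2) (r (Fin.snoc (z.2 ∘ i) z.1))) (P.prod (powMeasure P (Fin n))) := by
    intro i hi
    exact integrable_inner_of_norm_le_pow (V := fun z : S × (Fin n → S) => V z.2) hq
      (hW.comp_measurable measurable_snd).aestronglyMeasurable (fun z => hWV z.2)
      (hV.comp_measurePreserving measurePreserving_snd)
      (hr.comp_measurePreserving (measurePreserving_snoc_comp (mem_Inc.1 hi).injective))
  have e : ∀ z : S × (Fin n → S),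
      inner ℝ (W z.2) (tupleStat (fun s => r (Fin.snoc s z.1)) n z.2) =
        ∑ i ∈ Inc k n, inner ℝ (W z.2) (r (Fin.snoc (z.2 ∘ i) z.1)) := fun z => by
    rw [tupleStat, inner_sum]
  simp_rw [e]
  refine ⟨integrable_finsetSum _ hint, ?_⟩
  rw [integral_finsetSum _ hint]
  refine Finset.sum_eq_zero fun i hi => ?_
  rw [integral_prod_symm _ (hint i hi)]
  refine integral_eq_zero_of_ae ?_
  have hmp := measurePreserving_snoc_comp (P := P) (mem_Inc.1 hi).injective
  have hri : Integrable r (powMeasure P (Fin (k + 1))) :=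
    hr.integrable (by exact_mod_cast (by omega : 1 ≤ 2 * q))
  have h1 := (hmp.integrable_comp_of_integrable hri).prod_left_ae
  have h2 := (measurePreserving_precomp P (mem_Inc.1 hi).injective).quasiMeasurePreserving.ae
    hdeg.ae_integral_snoc
  filter_upwards [h1, h2] with s hs1 hs2
  have := integral_inner (𝕜 := ℝ) hs1 (W s)
  simp only [Function.comp_apply, Pi.zero_apply] at this ⊢
  rw [this, hs2, inner_zero_right]

omit [InnerProductSpace ℝ H] [CompleteSpace H] in
lemma memLp_tupleStat_slice {k n q : ℕ} {r : (Fin (k + 1) → S) → H}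
    (hr : MemLp r (2 * q : ℕ) (powMeasure P (Fin (k + 1)))) :
    MemLp (fun z : S × (Fin n → S) => tupleStat (fun s => r (Fin.snoc s z.1)) n z.2)
      (2 * q : ℕ) (P.prod (powMeasure P (Fin n))) := by
  refine memLp_finsetSum _ fun i hi => ?_
  exact hr.comp_measurePreserving (measurePreserving_snoc_comp (mem_Inc.1 hi).injective)

/-- Moment bound for canonical `U`-statistics. -/
theorem integral_norm_tupleStat_pow_le {q : ℕ} (hq : 1 ≤ q) {k : ℕ} {r : (Fin k → S) → H}
    (hrm : StronglyMeasurable r) (hr : MemLp r (2 * q : ℕ) (powMeasure P (Fin k)))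
    (hdeg : IsCanonical P r) (n : ℕ) :
    ∫ s, ‖tupleStat r n s‖ ^ (2 * q) ∂powMeasure P (Fin n) ≤
      ((8 * q * n : ℝ) ^ k) ^ q * ∫ s, ‖r s‖ ^ (2 * q) ∂powMeasure P (Fin k) := by
  have h2q : 2 * q ≠ 0 := by omega
  induction k generalizing n with
  | zero =>
    have h : ∀ s, r s = r default := fun s => by rw [Subsingleton.elim s default]
    simp_rw [tupleStat_zero_left, h]
    simp
  | succ k ih =>
    set R := ∫ s, ‖r s‖ ^ (2 * q) ∂powMeasure P (Fin (k + 1)) with hR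
    have hR0 : 0 ≤ R := integral_nonneg fun s => by positivity
    -- The induction hypothesis on the order applies to almost every slice of `r`; Fubini then
    -- recombines the slices.
    have hslice : ∀ n : ℕ, ∫ z : S × (Fin n → S),
        ‖tupleStat (fun s => r (Fin.snoc s z.1)) n z.2‖ ^ (2 * q) ∂(P.prod (powMeasure P (Fin n))) ≤
          ((8 * q * n : ℝ) ^ k) ^ q * R := by
      intro n
      have hI := (memLp_natCast_iff (memLp_tupleStat_slice (n := n) hr).1 h2q).2
        (memLp_tupleStat_slice hr)
      have hIr := (memLp_natCast_iff hr.1 h2q).2 hr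
      have hIr' := (measurePreserving_snoc P).integrable_comp_of_integrable hIr
      have hR' : R = ∫ x, ∫ s : Fin k → S, ‖r (Fin.snoc s x)‖ ^ (2 * q) ∂powMeasure P (Fin k) ∂P := by
        rw [hR, ← (measurePreserving_snoc P).map_eq, integral_map
          (measurePreserving_snoc P).measurable.aemeasurable (by
            rw [(measurePreserving_snoc P).map_eq]; exact hIr.1)]
        exact integral_prod _ hIr'
      rw [integral_prod _ hI, hR', ← integral_const_mul]
      refine integral_mono_ae hI.integral_prod_left (hIr'.integral_prod_left.const_mul _) ?_
      filter_upwards [hdeg.ae_slice, hIr'.prod_right_ae] with x hx1 hx2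
      have hm : StronglyMeasurable fun s : Fin k → S => r (Fin.snoc s x) :=
        hrm.comp_measurable ((measurePreserving_snoc P).measurable.comp measurable_prodMk_left)
      exact ih hm ((memLp_natCast_iff hm.aestronglyMeasurable h2q).1 hx2) hx1 n
    -- Freezing the factor n^k of the slice bound at N^k leaves a constant `c`, so induction on n
    -- has to produce only n^q.
    suffices hN : ∀ N n : ℕ, n ≤ N →
        ∫ s, ‖tupleStat r n s‖ ^ (2 * q) ∂powMeasure P (Fin n) ≤
          (n : ℝ) ^ q * ((8 * q) ^ q * (((8 * q * N : ℝ) ^ k) ^ q * R)) by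
      refine (hN n n le_rfl).trans (le_of_eq ?_)
      rw [pow_succ, mul_pow ((8 * (q : ℝ) * n) ^ k), mul_pow (8 * (q : ℝ)) (n : ℝ) q]
      ring
    intro N n
    set c := (8 * (q : ℝ)) ^ q * (((8 * q * N : ℝ) ^ k) ^ q * R) with hc
    have hc0 : 0 ≤ c := by positivity
    induction n with
    | zero =>
      intro _
      have h0 : ∀ s : Fin 0 → S, tupleStat r 0 s = 0 := fun s => tupleStat_of_lt (by omega) r s
      simp [h0, h2q, show q ≠ 0 by omega]
    | succ n ihn =>
      intro hnN
      have hn := ihn (by omega)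
      have hV := memLp_tupleStat hr n
      have hVI := (memLp_natCast_iff hV.1 h2q).2 hV
      have hVm := memLp_tupleStat hr (n + 1)
      have hVmI := (memLp_natCast_iff hVm.1 h2q).2 hVm
      have hDI := (memLp_natCast_iff (memLp_tupleStat_slice (n := n) hr).1 h2q).2
        (memLp_tupleStat_slice hr)
      have hVI' : Integrable (fun z : S × (Fin n → S) => ‖tupleStat r n z.2‖ ^ (2 * q))
          (P.prod (powMeasure P (Fin n))) :=
        measurePreserving_snd.integrable_comp_of_integrable hVI
      have hin := integral_inner_tupleStat_eq_zero hq hr hdeg hV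
        (W := fun s => ‖tupleStat r n s‖ ^ (2 * (q - 1)) • tupleStat r n s)
        (((stronglyMeasurable_tupleStat hrm n).norm.pow _).smul
          (stronglyMeasurable_tupleStat hrm n)) (fun s => by
          rw [norm_smul, norm_pow, norm_norm, ← pow_succ]
          exact le_of_eq (by congr 1; omega))
      simp only [real_inner_smul_left] at hin
      rw [← (measurePreserving_snoc P).map_eq, integral_map
          (measurePreserving_snoc P).measurable.aemeasurable (by
            rw [(measurePreserving_snoc P).map_eq]; exact hVmI.1)]
      set α : ℝ := n / (n + 1) * ((n + 1) / n) ^ q with hα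
      set β : ℝ := 1 / (n + 1) * (n + 1) ^ q with hβ
      have hα0 : 0 ≤ α := by positivity
      have hβ0 : 0 ≤ β := by positivity
      have hint₁ : Integrable (fun z : S × (Fin n → S) => α * ‖tupleStat r n z.2‖ ^ (2 * q) +
          (β * (8 * q) ^ q) * ‖tupleStat (fun s => r (Fin.snoc s z.1)) n z.2‖ ^ (2 * q))
          (P.prod (powMeasure P (Fin n))) := (hVI'.const_mul α).add (hDI.const_mul _)
      have hint := hint₁.add (hin.1.const_mul (2 * q))
      have hDb := (hslice n).trans (mul_le_mul_of_nonneg_right (pow_le_pow_left₀ (by positivity)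
        (pow_le_pow_left₀ (by positivity) (mul_le_mul_of_nonneg_left
          (show (n : ℝ) ≤ N by exact_mod_cast (by omega)) (by positivity)) k) q) hR0)
      calc _ ≤ ∫ z : S × (Fin n → S), ((α * ‖tupleStat r n z.2‖ ^ (2 * q) +
              (β * (8 * q) ^ q) * ‖tupleStat (fun s => r (Fin.snoc s z.1)) n z.2‖ ^ (2 * q)) +
              2 * q * (‖tupleStat r n z.2‖ ^ (2 * (q - 1)) * inner ℝ (tupleStat r n z.2)
                (tupleStat (fun s => r (Fin.snoc s z.1)) n z.2)))
              ∂(P.prod (powMeasure P (Fin n))) := by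
            refine integral_mono ((measurePreserving_snoc P).integrable_comp_of_integrable hVmI)
              hint fun z => ?_
            simp only [tupleStat_snoc]
            refine (norm_add_pow_le _ _ q).trans ?_
            gcongr
            refine (add_pow_le_weighted (by positivity) (by positivity) q n ?_).trans (le_of_eq ?_)
            · rintro rfl
              rw [tupleStat_of_lt (by omega)]; simp
            · rw [← hα, ← hβ, mul_pow, ← pow_mul, ← pow_mul]; ring
        _ = α * ∫ s, ‖tupleStat r n s‖ ^ (2 * q) ∂powMeasure P (Fin n) +
              (β * (8 * q) ^ q) * ∫ z : S × (Fin n → S),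
                ‖tupleStat (fun s => r (Fin.snoc s z.1)) n z.2‖ ^ (2 * q)
                ∂(P.prod (powMeasure P (Fin n))) := by
            rw [integral_add hint₁ (hin.1.const_mul _),
              integral_add (hVI'.const_mul α) (hDI.const_mul _), integral_const_mul,
              integral_const_mul, integral_const_mul, hin.2, mul_zero, add_zero]
            congr 2
            simpa using integral_fun_snd (μ := P) (ν := powMeasure P (Fin n)) (fun s => ‖tupleStat r n s‖ ^ (2 * q))
        _ ≤ α * (n ^ q * c) + (β * (8 * q) ^ q) * (((8 * q * N : ℝ) ^ k) ^ q * R) := by gcongr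
        _ = (α * n ^ q + β) * c := by rw [hc]; ring
        -- The weights were designed for α n^q + β = (n+1)^q.
        _ = _ := by
            congr 1
            rw [hα, hβ]
            rcases Nat.eq_zero_or_pos n with rfl | hn0
            · simp
            · have : (0 : ℝ) < n := by exact_mod_cast hn0
              push_cast
              rw [div_pow]
              field_simp
end

/-! ### Submartingale property and maximal inequality -/

section Maximal
variable {Ω S : Type*} [MeasurableSpace Ω] {μ : Measure Ω} [IsProbabilityMeasure μ]
  [MeasurableSpace S] {ξ : ℕ → Ω → S}

lemma measurable_initial (hξ : ∀ i, Measurable (ξ i)) (k : ℕ) : Measurable (initial ξ k) :=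
  measurable_pi_lambda _ fun l => hξ l

omit [IsProbabilityMeasure μ] in
lemma measurePreserving_initial (hξ : ∀ i, Measurable (ξ i)) (hind : iIndepFun ξ μ)
    (hid : ∀ i, IdentDistrib (ξ i) (ξ 0) μ μ) (k : ℕ) :
    MeasurePreserving (initial ξ k) μ (powMeasure (μ.map (ξ 0)) (Fin k)) := by
  refine ⟨measurable_initial hξ k, ?_⟩
  have hk : iIndepFun (fun l : Fin k => ξ l) μ := hind.precomp Fin.val_injective
  have h := iIndepFun.map_fun_eq_pi_map (f := fun l : Fin k => ξ l) (fun i => (hξ i).aemeasurable) hk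
  refine Eq.trans h ?_
  congr 1
  funext i
  exact (hid i).map_eq

lemma measurePreserving_prodMk_initial (hξ : ∀ i, Measurable (ξ i)) (hind : iIndepFun ξ μ)
    (hid : ∀ i, IdentDistrib (ξ i) (ξ 0) μ μ) (n : ℕ) :
    MeasurePreserving (fun ω => (ξ n ω, initial ξ n ω)) μ
      ((μ.map (ξ 0)).prod (powMeasure (μ.map (ξ 0)) (Fin n))) := by
  have : IsProbabilityMeasure (μ.map (ξ 0)) := Measure.isProbabilityMeasure_map (hξ 0).aemeasurable
  have h := (measurePreserving_piFinSuccAbove (α := fun _ => S) (fun _ => μ.map (ξ 0)) (Fin.last n)).comp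
    (measurePreserving_initial hξ hind hid (n + 1))
  convert h using 1
  funext ω
  refine Prod.ext rfl ?_
  funext l
  simp [initial, MeasurableEquiv.piFinSuccAbove, Fin.init]

omit [MeasurableSpace Ω] [MeasurableSpace S] in
lemma initial_succ (n : ℕ) (ω : Ω) :
    initial ξ (n + 1) ω = Fin.snoc (initial ξ n ω) (ξ n ω) := by
  funext l
  refine Fin.lastCases ?_ (fun l => ?_) l <;> simp [initial]

omit [MeasurableSpace Ω] [MeasurableSpace S] in
lemma uStat_eq_tupleStat {H : Type*} [AddCommMonoid H] {k : ℕ} (r : (Fin k → S) → H) (n : ℕ) (ω : Ω) :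
    uStat ξ r n ω = tupleStat r n (initial ξ n ω) := rfl

/-- The filtration generated by the sequence `ξ`. -/
def initialFiltration (hξ : ∀ i, Measurable (ξ i)) : Filtration ℕ ‹MeasurableSpace Ω› where
  seq n := MeasurableSpace.comap (initial ξ n) MeasurableSpace.pi
  mono' := by
    intro i j hij
    have : initial ξ i = (fun s : Fin j → S => fun l : Fin i => s (Fin.castLE hij l)) ∘ initial ξ j := rfl
    simp only
    rw [this, ← MeasurableSpace.comap_comp]
    refine MeasurableSpace.comap_mono (Measurable.comap_le ?_)
    exact measurable_pi_lambda _ fun l => measurable_pi_apply _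
  le' n := (measurable_initial hξ n).comap_le

variable {H : Type*} [NormedAddCommGroup H] [InnerProductSpace ℝ H] [CompleteSpace H]

lemma submartingale_norm_uStat_pow (hξ : ∀ i, Measurable (ξ i)) (hind : iIndepFun ξ μ)
    (hid : ∀ i, IdentDistrib (ξ i) (ξ 0) μ μ) {q : ℕ} (hq : 1 ≤ q) {k : ℕ} {r : (Fin k → S) → H}
    (hrm : StronglyMeasurable r) (hr : MemLp r (2 * q : ℕ) (powMeasure (μ.map (ξ 0)) (Fin k)))
    (hdeg : IsCanonical (μ.map (ξ 0)) r) :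
    Submartingale (fun n ω => ‖uStat ξ r n ω‖ ^ (2 * q)) (initialFiltration hξ) μ := by
  have h2q : 2 * q ≠ 0 := by omega
  have : IsProbabilityMeasure (μ.map (ξ 0)) := Measure.isProbabilityMeasure_map (hξ 0).aemeasurable
  have hint : ∀ n, Integrable (fun ω => ‖uStat ξ r n ω‖ ^ (2 * q)) μ := fun n =>
    (measurePreserving_initial hξ hind hid n).integrable_comp_of_integrable
      ((memLp_natCast_iff (memLp_tupleStat hr n).1 h2q).2 (memLp_tupleStat hr n))
  refine submartingale_of_setIntegral_le_succ (fun n => ?_) hint fun n A hA => ?_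
  · exact (((stronglyMeasurable_tupleStat hrm n).norm.pow (2 * q)).comp_measurable
      (comap_measurable _))
  obtain ⟨B, hB, rfl⟩ := hA
  have hAm := measurable_initial hξ n hB
  cases k with
  | zero => simp [uStat_eq_tupleStat, tupleStat_zero_left]
  | succ k =>
    -- The past event is built into `W` through the indicator of `B`, so the linear term integrates
    -- to zero over that event.
    have hin := integral_inner_tupleStat_eq_zero hq hr hdeg (memLp_tupleStat hr n)
      (W := B.indicator fun s => ‖tupleStat r n s‖ ^ (2 * (q - 1)) • tupleStat r n s)
      ((((stronglyMeasurable_tupleStat hrm n).norm.pow _).smul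
        (stronglyMeasurable_tupleStat hrm n)).indicator hB) (fun s => by
        refine (norm_indicator_le_norm_self _ _).trans ?_
        rw [norm_smul, norm_pow, norm_norm, ← pow_succ]
        exact le_of_eq (by congr 1; omega))
    have hmp := measurePreserving_prodMk_initial hξ hind hid n
    set Z : Ω → ℝ := fun ω => inner ℝ ((B.indicator fun s => ‖tupleStat r n s‖ ^ (2 * (q - 1)) •
      tupleStat r n s) (initial ξ n ω))
        (tupleStat (fun s => r (Fin.snoc s (ξ n ω))) n (initial ξ n ω)) with hZ
    have hZI : Integrable Z μ := hmp.integrable_comp_of_integrable hin.1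
    have hZ0 : ∫ ω, Z ω ∂μ = 0 := by
      rw [← hin.2, ← hmp.map_eq, integral_map hmp.measurable.aemeasurable
        (by rw [hmp.map_eq]; exact hin.1.1)]
    rw [← integral_indicator hAm, ← integral_indicator hAm]
    calc _ = ∫ ω, ((initial ξ n ⁻¹' B).indicator (fun ω => ‖uStat ξ r n ω‖ ^ (2 * q)) ω +
          2 * q * Z ω) ∂μ := by
          rw [integral_add ((hint n).indicator hAm) (hZI.const_mul _), integral_const_mul, hZ0,
            mul_zero, add_zero]
      _ ≤ _ := by
          refine integral_mono (((hint n).indicator hAm).add (hZI.const_mul _))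
            ((hint (n + 1)).indicator hAm) fun ω => ?_
          by_cases hω : initial ξ n ω ∈ B
          · simp only [hZ, Set.indicator, Set.mem_preimage, hω, if_true]
            rw [real_inner_smul_left, uStat_eq_tupleStat, uStat_eq_tupleStat, initial_succ,
              tupleStat_snoc]
            exact norm_pow_add_inner_le _ _ q
          · simp [hZ, Set.indicator, hω]

/-- Maximal inequality for canonical `U`-statistics. -/
theorem measure_exists_le_norm_uStat_le (hξ : ∀ i, Measurable (ξ i)) (hind : iIndepFun ξ μ)
    (hid : ∀ i, IdentDistrib (ξ i) (ξ 0) μ μ) {q : ℕ} (hq : 1 ≤ q) {k : ℕ} {r : (Fin k → S) → H}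
    (hrm : StronglyMeasurable r) (hr : MemLp r (2 * q : ℕ) (powMeasure (μ.map (ξ 0)) (Fin k)))
    (hdeg : IsCanonical (μ.map (ξ 0)) r) (N : ℕ) {l : ℝ} (hl : 0 < l) :
    μ {ω | ∃ n ≤ N, l ≤ ‖uStat ξ r n ω‖} ≤ ENNReal.ofReal (((8 * q * N : ℝ) ^ k) ^ q *
      (∫ s, ‖r s‖ ^ (2 * q) ∂powMeasure (μ.map (ξ 0)) (Fin k)) / l ^ (2 * q)) := by
  have : IsProbabilityMeasure (μ.map (ξ 0)) := Measure.isProbabilityMeasure_map (hξ 0).aemeasurable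
  have hsub := submartingale_norm_uStat_pow hξ hind hid hq hrm hr hdeg
  have hlp : 0 < l ^ (2 * q) := by positivity
  have hmax := maximal_ineq hsub (fun n ω => by positivity) (ε := (l ^ (2 * q)).toNNReal) N
  have hset : {ω | ∃ n ≤ N, l ≤ ‖uStat ξ r n ω‖} =
      {ω | ((l ^ (2 * q)).toNNReal : ℝ) ≤ (Finset.range (N + 1)).sup'
        Finset.nonempty_range_add_one fun n => ‖uStat ξ r n ω‖ ^ (2 * q)} := by
    ext ω
    simp only [Set.mem_ofPred_eq, Real.coe_toNNReal _ hlp.le, Finset.le_sup'_iff, Finset.mem_range, Nat.lt_succ_iff]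
    refine exists_congr fun n => and_congr_right fun _ => ?_
    exact (pow_le_pow_iff_left₀ hl.le (norm_nonneg _) (by omega)).symm
  rw [hset, ENNReal.ofReal_div_of_pos hlp, ENNReal.le_div_iff_mul_le
    (Or.inl (by simpa using hlp)) (Or.inl ENNReal.ofReal_ne_top), mul_comm]
  refine hmax.trans (ENNReal.ofReal_le_ofReal ?_)
  refine (setIntegral_le_integral (hsub.integrable N)
    (Filter.Eventually.of_forall fun ω => by positivity)).trans ?_
  have hmp := measurePreserving_initial hξ hind hid N
  have h2 : ∫ ω, ‖uStat ξ r N ω‖ ^ (2 * q) ∂μ =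
      ∫ s, ‖tupleStat r N s‖ ^ (2 * q) ∂powMeasure (μ.map (ξ 0)) (Fin N) := by
    have hm : StronglyMeasurable fun s => ‖tupleStat r N s‖ ^ (2 * q) :=
      (stronglyMeasurable_tupleStat hrm N).norm.pow _
    rw [← hmp.map_eq, integral_map hmp.measurable.aemeasurable hm.aestronglyMeasurable]
    rfl
  rw [h2]
  exact integral_norm_tupleStat_pow_le hq hrm hr hdeg N

end Maximal

lemma integral_comp_measurePreserving {α β E : Type*} [MeasurableSpace α] [MeasurableSpace β]
    {μ : Measure α} {ν : Measure β} [NormedAddCommGroup E] [NormedSpace ℝ E] {φ : α → β}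
    (hφ : MeasurePreserving φ μ ν) {f : β → E} (hf : AEStronglyMeasurable f ν) :
    ∫ x, f (φ x) ∂μ = ∫ y, f y ∂ν := by
  rw [← hφ.map_eq, integral_map hφ.measurable.aemeasurable (by rwa [hφ.map_eq])]

/-! ### Projection onto canonical kernels -/

section Projection
variable {S : Type*} [MeasurableSpace S] {P : Measure S} [IsProbabilityMeasure P]
variable {H : Type*} [NormedAddCommGroup H] [InnerProductSpace ℝ H]

variable (P) in
/-- The projection of a kernel on the canonical kernels. -/
noncomputable def canonicalPart {k : ℕ} (g : (Fin k → S) → H) (s : Fin k → S) : H :=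
  ∑ w : Finset (Fin k), (-1 : ℝ) ^ (k + w.card) • ∫ t, g (merge w s t) ∂powMeasure P (Fin k)

lemma stronglyMeasurable_integral_merge {k : ℕ} {g : (Fin k → S) → H} (hg : StronglyMeasurable g)
    (w : Finset (Fin k)) :
    StronglyMeasurable fun s => ∫ t, g (merge w s t) ∂powMeasure P (Fin k) :=
  (hg.comp_measurable (measurePreserving_merge P w).measurable).integral_prod_right'

lemma stronglyMeasurable_canonicalPart {k : ℕ} {g : (Fin k → S) → H} (hg : StronglyMeasurable g) :
    StronglyMeasurable (canonicalPart P g) :=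
  Finset.stronglyMeasurable_fun_sum _ fun w _ =>
    (stronglyMeasurable_integral_merge hg w).const_smul _

lemma ae_integrable_merge {k : ℕ} {E : Type*} [NormedAddCommGroup E] {g : (Fin k → S) → E}
    (hg : Integrable g (powMeasure P (Fin k))) :
    ∀ᵐ s ∂powMeasure P (Fin k), ∀ w : Finset (Fin k),
      Integrable (fun t => g (merge w s t)) (powMeasure P (Fin k)) :=
  ae_all_iff.2 fun w =>
    ((measurePreserving_merge P w).integrable_comp_of_integrable hg).prod_right_ae

lemma canonicalPart_add {k : ℕ} {g₁ g₂ : (Fin k → S) → H}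
    (hg₁ : Integrable g₁ (powMeasure P (Fin k))) (hg₂ : Integrable g₂ (powMeasure P (Fin k))) :
    canonicalPart P (fun s => g₁ s + g₂ s) =ᵐ[powMeasure P (Fin k)]
      fun s => canonicalPart P g₁ s + canonicalPart P g₂ s := by
  filter_upwards [ae_integrable_merge hg₁, ae_integrable_merge hg₂] with s h1 h2
  simp only [canonicalPart]
  rw [← Finset.sum_add_distrib]
  refine Finset.sum_congr rfl fun w _ => ?_
  rw [integral_add (h1 w) (h2 w), smul_add]

lemma norm_sum_pow_le {ι E : Type*} [NormedAddCommGroup E] (s : Finset ι) (f : ι → E) (p : ℕ) :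
    ‖∑ i ∈ s, f i‖ ^ (p + 1) ≤ (s.card : ℝ) ^ p * ∑ i ∈ s, ‖f i‖ ^ (p + 1) := by
  rcases s.eq_empty_or_nonempty with rfl | hs
  · simp
  refine (pow_le_pow_left₀ (norm_nonneg _) (norm_sum_le _ _) _).trans ?_
  have hc : (0 : ℝ) < s.card ^ p := by
    have : 0 < s.card := hs.card_pos
    positivity
  rw [← div_le_iff₀' hc]
  exact pow_sum_div_card_le_sum_pow (fun i _ => norm_nonneg _) p

lemma norm_integral_pow_le {α E : Type*} [MeasurableSpace α] {ν : Measure α} [IsProbabilityMeasure ν]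
    [NormedAddCommGroup E] [NormedSpace ℝ E] {f : α → E} {p : ℕ} (hf : Integrable f ν)
    (hfp : Integrable (fun x => ‖f x‖ ^ p) ν) :
    ‖∫ x, f x ∂ν‖ ^ p ≤ ∫ x, ‖f x‖ ^ p ∂ν := by
  refine (pow_le_pow_left₀ (norm_nonneg _) (norm_integral_le_integral_norm f) p).trans ?_
  have hconv : ConvexOn ℝ (Set.Ici 0) fun x : ℝ => x ^ p := convexOn_pow p
  exact hconv.map_integral_le (continuous_pow p).continuousOn isClosed_Ici
    (Filter.Eventually.of_forall fun x => norm_nonneg _) hf.norm hfp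

/-- The projection is a signed sum of 2^k averages, each an L^p contraction by Jensen's inequality.
-/
lemma integral_norm_canonicalPart_pow_le {k p : ℕ} (hp : p ≠ 0) {g : (Fin k → S) → H}
    (hgm : StronglyMeasurable g) (hg : MemLp g p (powMeasure P (Fin k))) :
    MemLp (canonicalPart P g) p (powMeasure P (Fin k)) ∧
      ∫ s, ‖canonicalPart P g s‖ ^ p ∂powMeasure P (Fin k) ≤
        (2 ^ k) ^ p * ∫ s, ‖g s‖ ^ p ∂powMeasure P (Fin k) := by
  have hgp := (memLp_natCast_iff hg.1 hp).2 hg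
  have hgi : Integrable g (powMeasure P (Fin k)) :=
    hg.integrable (by exact_mod_cast Nat.one_le_iff_ne_zero.2 hp)
  have hmp := fun w => (measurePreserving_merge P w).integrable_comp_of_integrable hgp
  have hb : ∀ w : Finset (Fin k), ∀ᵐ s ∂powMeasure P (Fin k),
      ‖∫ t, g (merge w s t) ∂powMeasure P (Fin k)‖ ^ p ≤
        ∫ t, ‖g (merge w s t)‖ ^ p ∂powMeasure P (Fin k) := by
    intro w
    filter_upwards [ae_integrable_merge hgi, ae_integrable_merge hgp] with s h1 h2
    exact norm_integral_pow_le (h1 w) (h2 w)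
  have hI : ∀ w : Finset (Fin k), Integrable
      (fun s => ‖∫ t, g (merge w s t) ∂powMeasure P (Fin k)‖ ^ p) (powMeasure P (Fin k)) := by
    intro w
    refine (hmp w).integral_prod_left.mono'
      ((stronglyMeasurable_integral_merge hgm w).norm.pow p).aestronglyMeasurable ?_
    filter_upwards [hb w] with s hs
    rw [Real.norm_of_nonneg (by positivity)]
    exact hs
  have hle : ∀ w : Finset (Fin k),
      ∫ s, ‖∫ t, g (merge w s t) ∂powMeasure P (Fin k)‖ ^ p ∂powMeasure P (Fin k) ≤
        ∫ s, ‖g s‖ ^ p ∂powMeasure P (Fin k) := by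
    intro w
    refine (integral_mono_ae (hI w) (hmp w).integral_prod_left (hb w)).trans (le_of_eq ?_)
    rw [← integral_comp_measurePreserving (measurePreserving_merge P w) hgp.1]
    exact (integral_prod _ (hmp w)).symm
  obtain ⟨p, rfl⟩ : ∃ p', p = p' + 1 := Nat.exists_eq_succ_of_ne_zero hp
  have hmem : MemLp (canonicalPart P g) (p + 1 : ℕ) (powMeasure P (Fin k)) := by
    refine memLp_finsetSum _ fun w _ => ?_
    exact ((memLp_natCast_iff (stronglyMeasurable_integral_merge hgm w).aestronglyMeasurable hp).1
      (hI w)).const_smul _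
  refine ⟨hmem, ?_⟩
  have hcard : (Finset.univ : Finset (Finset (Fin k))).card = 2 ^ k := by simp
  calc _ ≤ ∫ s, ((2 ^ k : ℝ) ^ p * ∑ w : Finset (Fin k),
          ‖∫ t, g (merge w s t) ∂powMeasure P (Fin k)‖ ^ (p + 1)) ∂powMeasure P (Fin k) := by
        refine integral_mono ((memLp_natCast_iff hmem.1 hp).2 hmem)
          ((integrable_finsetSum _ fun w _ => hI w).const_mul _) fun s => ?_
        have := norm_sum_pow_le Finset.univ (fun w : Finset (Fin k) =>
          (-1 : ℝ) ^ (k + w.card) • ∫ t, g (merge w s t) ∂powMeasure P (Fin k)) p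
        simp only [norm_smul, norm_pow, norm_neg, norm_one, one_pow, one_mul, hcard,
          Nat.cast_pow, Nat.cast_ofNat] at this
        exact this
    _ = (2 ^ k : ℝ) ^ p * ∑ w : Finset (Fin k), ∫ s,
          ‖∫ t, g (merge w s t) ∂powMeasure P (Fin k)‖ ^ (p + 1) ∂powMeasure P (Fin k) := by
        rw [integral_const_mul, integral_finsetSum _ fun w _ => hI w]
    _ ≤ (2 ^ k : ℝ) ^ p * ∑ w : Finset (Fin k), ∫ s, ‖g s‖ ^ (p + 1) ∂powMeasure P (Fin k) := by
        exact mul_le_mul_of_nonneg_left (Finset.sum_le_sum fun w _ => hle w) (by positivity)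
    _ = _ := by
        rw [Finset.sum_const, hcard, nsmul_eq_mul]
        push_cast
        ring

omit [MeasurableSpace S] in
lemma merge_update_of_notMem {ι : Type*} [DecidableEq ι] {w : Finset ι} {i : ι} (hi : i ∉ w)
    (s t : ι → S) (x : S) : merge w (Function.update s i x) t = merge w s t := by
  funext j
  simp only [merge, Function.update_apply]
  split_ifs <;> simp_all

omit [MeasurableSpace S] in
lemma merge_insert_update {ι : Type*} [DecidableEq ι] {w : Finset ι} {i : ι} (hi : i ∉ w)
    (s t : ι → S) (x : S) :
    merge (insert i w) (Function.update s i x) t = merge w s (Function.update t i x) := by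
  funext j
  simp only [merge, Function.update_apply, Finset.mem_insert]
  split_ifs <;> simp_all

/-- The projection is the expanded product over i of (identity minus averaging in variable i).
Integrating out variable i makes the terms of w and of w with i inserted equal up to opposite signs.
-/
lemma isCanonical_canonicalPart [CompleteSpace H] {k : ℕ} {g : (Fin k → S) → H} (hgm : StronglyMeasurable g)
    (hg : Integrable g (powMeasure P (Fin k))) : IsCanonical P (canonicalPart P g) := by
  intro i
  have hmp : ∀ w : Finset (Fin k), MeasurePreserving
      (fun z : (Fin k → S) × (S × (Fin k → S)) => merge w (Function.update z.1 i z.2.1) z.2.2)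
      ((powMeasure P (Fin k)).prod (P.prod (powMeasure P (Fin k)))) (powMeasure P (Fin k)) := by
    intro w
    exact (measurePreserving_merge P w).comp
      (((measurePreserving_update P i).prod (MeasurePreserving.id _)).comp
        (measurePreserving_prodAssoc (powMeasure P (Fin k)) P (powMeasure P (Fin k))).symm)
  have hae : ∀ᵐ s ∂powMeasure P (Fin k), ∀ w : Finset (Fin k),
      Integrable (fun z : S × (Fin k → S) => g (merge w (Function.update s i z.1) z.2))
        (P.prod (powMeasure P (Fin k))) :=
    ae_all_iff.2 fun w => ((hmp w).integrable_comp_of_integrable hg).prod_right_ae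
  filter_upwards [hae] with s hs
  have hmerge : ∀ w : Finset (Fin k), StronglyMeasurable fun t => g (merge w s t) := fun w =>
    hgm.comp_measurable ((measurePreserving_merge P w).measurable.comp measurable_prodMk_left)
  have hnot : ∀ w : Finset (Fin k), i ∉ w →
      ∫ x, ∫ t, g (merge w (Function.update s i x) t) ∂powMeasure P (Fin k) ∂P =
        ∫ t, g (merge w s t) ∂powMeasure P (Fin k) := by
    intro w hw
    simp [merge_update_of_notMem hw]
  have hins : ∀ w : Finset (Fin k), i ∉ w →
      ∫ x, ∫ t, g (merge (insert i w) (Function.update s i x) t) ∂powMeasure P (Fin k) ∂P =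
        ∫ t, g (merge w s t) ∂powMeasure P (Fin k) := by
    intro w hw
    have h1 := hs (insert i w)
    rw [integral_integral h1]
    simp only [merge_insert_update hw]
    rw [← integral_comp_measurePreserving (measurePreserving_update P i)
      (hmerge w).aestronglyMeasurable, ← integral_prod_swap]
    rfl
  have hsplit : ∀ f : Finset (Fin k) → H, ∑ w, f w =
      ∑ w ∈ (Finset.univ.erase i).powerset, (f w + f (insert i w)) := by
    intro f
    rw [Finset.sum_add_distrib, ← Finset.sum_powerset_insert (Finset.notMem_erase i _),
      Finset.insert_erase (Finset.mem_univ i), Finset.powerset_univ]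
  simp only [canonicalPart]
  have hsI : ∀ w ∈ Finset.univ, Integrable (fun x => (-1 : ℝ) ^ (k + w.card) •
      ∫ t, g (merge w (Function.update s i x) t) ∂powMeasure P (Fin k)) P :=
    fun w _ => (hs w).integral_prod_left.smul _
  rw [integral_finsetSum _ hsI]
  simp only [integral_smul]
  rw [hsplit]
  refine Finset.sum_eq_zero fun w hw => ?_
  have hi : i ∉ w := fun h => Finset.notMem_erase i _ (Finset.mem_powerset.1 hw h)
  rw [hnot w hi, hins w hi, Finset.card_insert_of_notMem hi, ← add_assoc, pow_succ]
  simp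

end Projection

lemma measurable_glue_right {S : Type*} [MeasurableSpace S] {k m : ℕ} (s : Fin k → S) :
    Measurable (glue s : (Fin m → S) → Fin m → S) := by
  refine measurable_pi_lambda _ fun l => ?_
  unfold glue
  split_ifs
  · exact measurable_const
  · exact measurable_pi_apply l

/-! ### Hoeffding kernels as canonical projections -/

section Hoeffding
variable {S : Type*} [MeasurableSpace S] {P : Measure S} [IsProbabilityMeasure P]
variable {E : Type*} [NormedAddCommGroup E] [NormedSpace ℝ E]

variable (P) in
/-- The mean of the kernel `h` given its first `k` arguments. -/
noncomputable def partialMean {m : ℕ} (h : (Fin m → S) → E) (k : ℕ) (s : Fin k → S) : E :=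
  ∫ t, h (glue s t) ∂powMeasure P (Fin m)

lemma stronglyMeasurable_partialMean {m : ℕ} {h : (Fin m → S) → E} (hh : StronglyMeasurable h)
    (k : ℕ) : StronglyMeasurable (partialMean P h k) :=
  (hh.comp_measurable (measurePreserving_glue P).measurable).integral_prod_right'

lemma integrable_partialMean {m : ℕ} {h : (Fin m → S) → E}
    (hh : Integrable h (powMeasure P (Fin m))) (k : ℕ) :
    Integrable (partialMean P h k) (powMeasure P (Fin k)) :=
  ((measurePreserving_glue P).integrable_comp_of_integrable hh).integral_prod_left

lemma partialMean_self [CompleteSpace E] {m : ℕ} (h : (Fin m → S) → E) : partialMean P h m = h := by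
  funext s
  have : ∀ t : Fin m → S, glue s t = s := fun t => by funext l; simp [glue]
  simp [partialMean, this]

lemma exists_perm_castLE {j k m : ℕ} (hkm : k ≤ m) {u : Fin j → Fin k} (hu : u.Injective) :
    ∃ σ : Equiv.Perm (Fin m), ∀ (l : Fin m) (hl : (l : ℕ) < j),
      σ l = Fin.castLE hkm (u ⟨l, hl⟩) := by
  have hjk : j ≤ k := by simpa using Fintype.card_le_of_injective u hu
  set a : Fin j → Fin m := Fin.castLE (hjk.trans hkm)
  set b : Fin j → Fin m := Fin.castLE hkm ∘ u
  have ha : a.Injective := Fin.castLE_injective _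
  have hb : b.Injective := (Fin.castLE_injective _).comp hu
  classical
  set e : {x // x ∈ Set.range a} ≃ {x // x ∈ Set.range b} :=
    (Equiv.ofInjective a ha).symm.trans (Equiv.ofInjective b hb) with he
  refine ⟨e.extendSubtype, fun l hl => ?_⟩
  have hla : a ⟨l, hl⟩ = l := rfl
  have hmem : l ∈ Set.range a := ⟨⟨l, hl⟩, hla⟩
  rw [Equiv.extendSubtype_apply_of_mem e l hmem]
  have : (Equiv.ofInjective a ha).symm ⟨l, hmem⟩ = ⟨l, hl⟩ := by
    rw [Equiv.symm_apply_eq]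
    rfl
  rw [he, Equiv.trans_apply, this]
  rfl

/-- Integrating a partial mean over the arguments outside `u`. -/
lemma ae_integral_partialMean_merge {k m : ℕ} (hkm : k ≤ m) {h : (Fin m → S) → E}
    (hhm : StronglyMeasurable h) (hsymm : IsSymmetric h) (hh : Integrable h (powMeasure P (Fin m))) :
    ∀ᵐ s ∂powMeasure P (Fin k), ∀ (j : ℕ) (u : Fin j → Fin k), u.Injective →
      ∫ t, partialMean P h k (merge (Finset.univ.image u) s t) ∂powMeasure P (Fin k) =
        partialMean P h j (s ∘ u) := by
  have hmp : ∀ w : Finset (Fin k), MeasurePreserving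
      (fun z : (Fin k → S) × ((Fin k → S) × (Fin m → S)) =>
        (glue (merge w z.1 z.2.1) z.2.2 : Fin m → S))
      ((powMeasure P (Fin k)).prod ((powMeasure P (Fin k)).prod (powMeasure P (Fin m))))
      (powMeasure P (Fin m)) := fun w =>
    (measurePreserving_glue P).comp
      (((measurePreserving_merge P w).prod (MeasurePreserving.id _)).comp
        (measurePreserving_prodAssoc (powMeasure P (Fin k)) (powMeasure P (Fin k))
          (powMeasure P (Fin m))).symm)
  have hae : ∀ᵐ s ∂powMeasure P (Fin k), ∀ w : Finset (Fin k),
      Integrable (fun z : (Fin k → S) × (Fin m → S) => h (glue (merge w s z.1) z.2))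
        ((powMeasure P (Fin k)).prod (powMeasure P (Fin m))) :=
    ae_all_iff.2 fun w => ((hmp w).integrable_comp_of_integrable hh).prod_right_ae
  filter_upwards [hae] with s hs j u hu
  obtain ⟨σ, hσ⟩ := exists_perm_castLE hkm hu
  have hmu : Measurable fun t : Fin m → S => (glue (s ∘ u) t : Fin m → S) :=
    measurable_glue_right _
  -- By symmetry the arguments may be permuted by `σ`, which moves the entries retained from `s`
  -- into the first j places; the remaining ones are distinct coordinates of a fresh sample.
  have hpt : ∀ z : (Fin k → S) × (Fin m → S),
      h (glue (merge (Finset.univ.image u) s z.1) z.2) =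
        h (glue (s ∘ u) (glue z.1 z.2 ∘ σ)) := by
    intro z
    rw [← hsymm σ]
    congr 1
    funext l
    by_cases hl : (l : ℕ) < j
    · have hlt : ((σ l : Fin m) : ℕ) < k := by rw [hσ l hl]; exact (u ⟨l, hl⟩).2
      have hval : (⟨(σ l : Fin m), hlt⟩ : Fin k) = u ⟨l, hl⟩ := by
        ext; simp [hσ l hl]
      simp only [glue, hlt, hl, dif_pos, merge, hval, Function.comp]
      simp
    · have hnot : ∀ hlt : ((σ l : Fin m) : ℕ) < k,
          (⟨(σ l : Fin m), hlt⟩ : Fin k) ∉ Finset.univ.image u := by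
        intro hlt hmem
        obtain ⟨l', -, hl'⟩ := Finset.mem_image.1 hmem
        have hl'm : (l' : ℕ) < m := by
          have : j ≤ k := by simpa using Fintype.card_le_of_injective u hu
          omega
        have h1 := hσ ⟨l', hl'm⟩ l'.2
        have h2 : σ ⟨l', hl'm⟩ = σ l := by
          rw [h1]
          ext
          simp [hl']
        have := congrArg Fin.val (σ.injective h2)
        simp only at this
        exact hl (this ▸ l'.2)
      simp only [glue, hl, dif_neg, not_false_eq_true, Function.comp, merge]
      split_ifs with h1 h2
      · exact absurd h2 (hnot h1)
      · rfl
      · rfl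
  have h2 : StronglyMeasurable fun t : Fin m → S => h (glue (s ∘ u) (t ∘ σ)) :=
    hhm.comp_measurable (hmu.comp (measurable_pi_lambda _ fun l => measurable_pi_apply _))
  calc _ = ∫ z : (Fin k → S) × (Fin m → S), h (glue (merge (Finset.univ.image u) s z.1) z.2)
          ∂(powMeasure P (Fin k)).prod (powMeasure P (Fin m)) := integral_integral (hs _)
    _ = ∫ z : (Fin k → S) × (Fin m → S), h (glue (s ∘ u) (glue z.1 z.2 ∘ σ))
          ∂(powMeasure P (Fin k)).prod (powMeasure P (Fin m)) := by simp_rw [hpt]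
    _ = ∫ t : Fin m → S, h (glue (s ∘ u) (t ∘ σ)) ∂powMeasure P (Fin m) :=
        integral_comp_measurePreserving (measurePreserving_glue P) h2.aestronglyMeasurable
    _ = _ := integral_comp_measurePreserving (measurePreserving_precomp P σ.injective)
        (hhm.comp_measurable hmu).aestronglyMeasurable

/-- Subsets are grouped by cardinality j and enumerated increasingly. The equality is only almost
sure, because merging two integrations requires integrable slices. -/
lemma ae_sum_partialMean_eq_canonicalPart {H : Type*} [NormedAddCommGroup H] [InnerProductSpace ℝ H]
    {k m : ℕ} (hkm : k ≤ m) {h : (Fin m → S) → H}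
    (hhm : StronglyMeasurable h) (hsymm : IsSymmetric h) (hh : Integrable h (powMeasure P (Fin m))) :
    (fun s => ∑ j ∈ Finset.range (k + 1), (-1 : ℝ) ^ (k - j) •
      ∑ u ∈ Inc j k, partialMean P h j (s ∘ u)) =ᵐ[powMeasure P (Fin k)]
        canonicalPart P (partialMean P h k) := by
  filter_upwards [ae_integral_partialMean_merge hkm hhm hsymm hh] with s hs
  rw [canonicalPart, ← Finset.powerset_univ, Finset.sum_powerset]
  simp only [Finset.card_univ, Fintype.card_fin]
  refine Finset.sum_congr rfl fun j hj => ?_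
  have hjk := Nat.lt_succ_iff.1 (Finset.mem_range.1 hj)
  have hsign : (-1 : ℝ) ^ (k + j) = (-1) ^ (k - j) := by
    rw [show k + j = (k - j) + 2 * j by omega, pow_add, pow_mul]; simp
  rw [← sum_Inc_eq_sum_powersetCard (fun w => (-1 : ℝ) ^ (k + w.card) •
    ∫ t, partialMean P h k (merge w s t) ∂powMeasure P (Fin k)), Finset.smul_sum]
  refine Finset.sum_congr rfl fun u hu => ?_
  have hui := (mem_Inc.1 hu).injective
  rw [hs j u hui, Finset.card_image_of_injective _ hui, Finset.card_univ, Fintype.card_fin, hsign]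

end Hoeffding

/-! ### Transfer to the random sequence -/

section Sequence
variable {Ω S : Type*} [MeasurableSpace Ω] {μ : Measure Ω} [IsProbabilityMeasure μ]
  [MeasurableSpace S] {ξ : ℕ → Ω → S}

lemma hoeffdingKernel_eq_sum_partialMean {H : Type*} [NormedAddCommGroup H] [NormedSpace ℝ H]
    (hξ : ∀ i, Measurable (ξ i)) (hind : iIndepFun ξ μ)
    (hid : ∀ i, IdentDistrib (ξ i) (ξ 0) μ μ) {m : ℕ} {h : (Fin m → S) → H}
    (hhm : StronglyMeasurable h) (k : ℕ) :
    hoeffdingKernel μ ξ h k = fun s => ∑ j ∈ Finset.range (k + 1), (-1 : ℝ) ^ (k - j) •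
      ∑ u ∈ Inc j k, partialMean (μ.map (ξ 0)) h j (s ∘ u) := by
  have : IsProbabilityMeasure (μ.map (ξ 0)) := Measure.isProbabilityMeasure_map (hξ 0).aemeasurable
  funext s
  refine Finset.sum_congr rfl fun j _ => ?_
  congr 1
  refine Finset.sum_congr rfl fun u _ => ?_
  have hm : StronglyMeasurable fun t : Fin m → S => h (glue (s ∘ u) t) :=
    hhm.comp_measurable (measurable_glue_right _)
  exact integral_comp_measurePreserving (measurePreserving_initial hξ hind hid m)
    hm.aestronglyMeasurable

/-- By independence, conditioning on the first k observations amounts to integrating out the others;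
this is checked on the events generated by those observations. -/
lemma condNorm_ae_eq {H : Type*} [NormedAddCommGroup H] (hξ : ∀ i, Measurable (ξ i))
    (hind : iIndepFun ξ μ) (hid : ∀ i, IdentDistrib (ξ i) (ξ 0) μ μ) {k m : ℕ} (hkm : k ≤ m)
    {h : (Fin m → S) → H} (hhm : StronglyMeasurable h)
    (hh : Integrable h (powMeasure (μ.map (ξ 0)) (Fin m))) :
    condNorm μ ξ h k =ᵐ[μ]
      fun ω => partialMean (μ.map (ξ 0)) (fun s => ‖h s‖) k (initial ξ k ω) := by
  have : IsProbabilityMeasure (μ.map (ξ 0)) := Measure.isProbabilityMeasure_map (hξ 0).aemeasurable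
  have hmk := measurePreserving_initial hξ hind hid k
  have hmm := measurePreserving_initial hξ hind hid m
  have hG : Integrable (fun ω => partialMean (μ.map (ξ 0)) (fun s => ‖h s‖) k (initial ξ k ω)) μ :=
    hmk.integrable_comp_of_integrable (integrable_partialMean hh.norm k)
  symm
  refine ae_eq_condExp_of_forall_setIntegral_eq (measurable_initial hξ k).comap_le
    (hmm.integrable_comp_of_integrable hh.norm) (fun A _ _ => hG.integrableOn) (fun A hA _ => ?_)
    ((stronglyMeasurable_partialMean hhm.norm k).comp_measurable
      (comap_measurable _)).aestronglyMeasurable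
  obtain ⟨B, hB, rfl⟩ := hA
  have hAm := measurable_initial hξ k hB
  have hφ : Measurable fun t : Fin m → S => t ∘ Fin.castLE hkm :=
    measurable_pi_lambda _ fun l => measurable_pi_apply _
  rw [← integral_indicator hAm, ← integral_indicator hAm]
  have e1 : (initial ξ k ⁻¹' B).indicator
      (fun ω => partialMean (μ.map (ξ 0)) (fun s => ‖h s‖) k (initial ξ k ω)) =
      fun ω => B.indicator (partialMean (μ.map (ξ 0)) (fun s => ‖h s‖) k) (initial ξ k ω) := rfl
  have e2 : (initial ξ k ⁻¹' B).indicator (fun ω => ‖h (initial ξ m ω)‖) =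
      fun ω => ((fun t : Fin m → S => t ∘ Fin.castLE hkm) ⁻¹' B).indicator (fun t => ‖h t‖)
        (initial ξ m ω) := rfl
  have hI := hh.norm.indicator (hφ hB)
  have hI' := (measurePreserving_glue (k := k) (μ.map (ξ 0))).integrable_comp_of_integrable hI
  rw [e1, e2, integral_comp_measurePreserving hmk
      ((stronglyMeasurable_partialMean hhm.norm k).indicator hB).aestronglyMeasurable,
    integral_comp_measurePreserving hmm hI.1,
    ← integral_comp_measurePreserving (measurePreserving_glue (k := k) (μ.map (ξ 0))) hI.1]
  refine Eq.trans ?_ (integral_prod _ hI').symm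
  congr 1
  funext s
  have hgl : ∀ t : Fin m → S, (glue s t : Fin m → S) ∘ Fin.castLE hkm = s := by
    intro t; funext l; simp [glue]
  by_cases hs : s ∈ B
  · simp [Set.indicator, hs, hgl, partialMean]
  · simp [Set.indicator, hs, hgl]

end Sequence

/-! ### Truncation and tail integrals -/

/-- Halving the threshold extends the domain to u < 2a/M. On (a/M, 2a/M), of length a/M, the
integrand is at least a/M, which already gives (a/M)². -/
lemma ofReal_sq_le_lintegral {a M : ℝ} (hM : 0 < M) (ha : M < a) :
    ENNReal.ofReal (a ^ 2) ≤ ENNReal.ofReal (M ^ 2) *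
      ∫⁻ u in Set.Ioi (1 : ℝ), {u : ℝ | M / 2 * u < a}.indicator (fun u => ENNReal.ofReal u) u := by
  have hb : 1 < a / M := (one_lt_div hM).2 ha
  have h1 : ENNReal.ofReal ((a / M) ^ 2) ≤ ∫⁻ u in Set.Ioi (1 : ℝ),
      {u : ℝ | M / 2 * u < a}.indicator (fun u => ENNReal.ofReal u) u := by
    calc ENNReal.ofReal ((a / M) ^ 2)
        = ∫⁻ _ in Set.Ioo (a / M) (2 * (a / M)), ENNReal.ofReal (a / M) := by
          rw [setLIntegral_const, Real.volume_Ioo, ← ENNReal.ofReal_mul (by positivity)]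
          congr 1; ring
      _ ≤ ∫⁻ u in Set.Ioo (a / M) (2 * (a / M)),
            {u : ℝ | M / 2 * u < a}.indicator (fun u => ENNReal.ofReal u) u := by
          refine setLIntegral_mono' measurableSet_Ioo fun u hu => ?_
          have hmem : u ∈ {u : ℝ | M / 2 * u < a} := by
            have h2 := hu.2
            calc M / 2 * u < M / 2 * (2 * (a / M)) := by gcongr
              _ = a := by field_simp
          rw [Set.indicator_of_mem hmem]
          exact ENNReal.ofReal_le_ofReal hu.1.le
      _ ≤ _ := lintegral_mono_set fun u hu => hb.trans hu.1
  calc ENNReal.ofReal (a ^ 2) = ENNReal.ofReal (M ^ 2) * ENNReal.ofReal ((a / M) ^ 2) := by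
        rw [← ENNReal.ofReal_mul (by positivity)]
        congr 1; field_simp
    _ ≤ _ := by gcongr

/-- Second moment of a truncated function in terms of its tail. -/
lemma lintegral_truncated_sq_le {α E : Type*} [MeasurableSpace α] {ν : Measure α} [SFinite ν]
    [NormedAddCommGroup E] {g : α → E} (hg : StronglyMeasurable g) {M : ℝ} (hM : 0 < M) :
    ∫⁻ s, ENNReal.ofReal (‖{s | M < ‖g s‖}.indicator g s‖ ^ 2) ∂ν ≤ ENNReal.ofReal (M ^ 2) *
      ∫⁻ u in Set.Ioi (1 : ℝ), ν {s | M / 2 * u < ‖g s‖} * ENNReal.ofReal u := by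
  have hms : MeasurableSet {z : α × ℝ | M / 2 * z.2 < ‖g z.1‖} :=
    measurableSet_lt (measurable_snd.const_mul _) (hg.norm.measurable.comp measurable_fst)
  have hmeas : Measurable (Function.uncurry fun (s : α) (u : ℝ) =>
      {u : ℝ | M / 2 * u < ‖g s‖}.indicator (fun u => ENNReal.ofReal u) u) := by
    have : (Function.uncurry fun (s : α) (u : ℝ) =>
        {u : ℝ | M / 2 * u < ‖g s‖}.indicator (fun u => ENNReal.ofReal u) u) =
        {z : α × ℝ | M / 2 * z.2 < ‖g z.1‖}.indicator fun z => ENNReal.ofReal z.2 := rfl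
    rw [this]
    exact (ENNReal.measurable_ofReal.comp measurable_snd).indicator hms
  calc _ ≤ ∫⁻ s, ENNReal.ofReal (M ^ 2) * (∫⁻ u in Set.Ioi (1 : ℝ),
          {u : ℝ | M / 2 * u < ‖g s‖}.indicator (fun u => ENNReal.ofReal u) u) ∂ν := by
        refine lintegral_mono fun s => ?_
        by_cases hs : M < ‖g s‖
        · rw [Set.indicator_of_mem (show s ∈ {s | M < ‖g s‖} from hs)]
          exact ofReal_sq_le_lintegral hM hs
        · rw [Set.indicator_of_notMem (show s ∉ {s | M < ‖g s‖} from hs)]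
          simp
    _ = ENNReal.ofReal (M ^ 2) * ∫⁻ u in Set.Ioi (1 : ℝ), ∫⁻ s,
          {u : ℝ | M / 2 * u < ‖g s‖}.indicator (fun u => ENNReal.ofReal u) u ∂ν := by
        rw [lintegral_const_mul' _ _ ENNReal.ofReal_ne_top, lintegral_lintegral_swap]
        exact hmeas.aemeasurable
    _ = _ := by
        congr 1
        refine lintegral_congr fun u => ?_
        have hu : MeasurableSet {s | M / 2 * u < ‖g s‖} :=
          measurableSet_lt measurable_const hg.norm.measurable
        rw [mul_comm, ← lintegral_indicator_const hu]
        rfl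

/-- This fixes the truncation level y/(4·8^k): the ratio raised to the power q in the moment bound
is then at most 1/4, below 1/e. -/
lemma four_mul_pow_bound {k : ℕ} (hk : 1 ≤ k) {x y : ℝ} (hx : 0 < x) (hy : 0 < y)
    {q : ℕ} (hq : (q : ℝ) ≤ 2 * (x / y) ^ (2 / (k : ℝ))) :
    (8 * q : ℝ) ^ k * (2 ^ k) ^ 2 * (1 / (4 * 8 ^ k) * y) ^ 2 / (x / 2) ^ 2 ≤ Real.exp (-1) := by
  have hk' : (k : ℝ) ≠ 0 := by exact_mod_cast (by omega : k ≠ 0)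
  have hz : ((x / y) ^ (2 / (k : ℝ))) ^ k = (x / y) ^ 2 := by
    rw [← Real.rpow_natCast, ← Real.rpow_mul (by positivity), div_mul_cancel₀ _ hk']
    exact Real.rpow_natCast _ 2
  have h1 : (q : ℝ) ^ k ≤ 2 ^ k * (x / y) ^ 2 := by
    rw [← hz, ← mul_pow]
    exact pow_le_pow_left₀ (by positivity) hq k
  have h4 : (1 / 4 : ℝ) ≤ Real.exp (-1) := by
    rw [Real.exp_neg, ← one_div]
    have := Real.exp_one_lt_three
    exact one_div_le_one_div_of_le (Real.exp_pos 1) (by linarith)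
  refine le_trans ?_ h4
  have e8 : (8 : ℝ) ^ k = 2 ^ k * 2 ^ k * 2 ^ k := by rw [← mul_pow, ← mul_pow]; norm_num
  calc _ = (8 : ℝ) ^ k * (q : ℝ) ^ k * (2 ^ k) ^ 2 * (1 / (4 * 8 ^ k) * y) ^ 2 / (x / 2) ^ 2 := by
        rw [mul_pow]
    _ ≤ (8 : ℝ) ^ k * (2 ^ k * (x / y) ^ 2) * (2 ^ k) ^ 2 * (1 / (4 * 8 ^ k) * y) ^ 2 /
          (x / 2) ^ 2 := by gcongr
    _ = 1 / 4 := by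
        rw [e8]
        field_simp
        norm_num

/-! ### Tail inequality for a projected kernel -/

section Tail
variable {Ω S : Type*} [MeasurableSpace Ω] {μ : Measure Ω} [IsProbabilityMeasure μ]
  [MeasurableSpace S] {ξ : ℕ → Ω → S}
variable {H : Type*} [NormedAddCommGroup H] [InnerProductSpace ℝ H] [CompleteSpace H]

omit [InnerProductSpace ℝ H] [CompleteSpace H] in
lemma ae_uStat_congr (hξ : ∀ i, Measurable (ξ i)) (hind : iIndepFun ξ μ)
    (hid : ∀ i, IdentDistrib (ξ i) (ξ 0) μ μ) {k : ℕ} {r₁ r₂ : (Fin k → S) → H}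
    (h : r₁ =ᵐ[powMeasure (μ.map (ξ 0)) (Fin k)] r₂) :
    ∀ᵐ ω ∂μ, ∀ n, uStat ξ r₁ n ω = uStat ξ r₂ n ω := by
  have : IsProbabilityMeasure (μ.map (ξ 0)) := Measure.isProbabilityMeasure_map (hξ 0).aemeasurable
  refine ae_all_iff.2 fun n => ?_
  have h1 : ∀ᵐ ω ∂μ, ∀ i ∈ Inc k n, r₁ (initial ξ n ω ∘ i) = r₂ (initial ξ n ω ∘ i) := by
    refine (Finset.eventually_all _).2 fun i hi => ?_
    exact ((measurePreserving_precomp _ (mem_Inc.1 hi).injective).comp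
      (measurePreserving_initial hξ hind hid n)).quasiMeasurePreserving.ae h
  filter_upwards [h1] with ω hω
  exact Finset.sum_congr rfl hω

/-- Tail inequality for the `U`-statistics of the canonical part of a kernel. -/
theorem measure_uStat_canonicalPart_le (hξ : ∀ i, Measurable (ξ i)) (hind : iIndepFun ξ μ)
    (hid : ∀ i, IdentDistrib (ξ i) (ξ 0) μ μ) {k : ℕ} (hk : 1 ≤ k) {g : (Fin k → S) → H}
    (hgm : StronglyMeasurable g) (hg : Integrable g (powMeasure (μ.map (ξ 0)) (Fin k)))
    {N : ℕ} (hN : 1 ≤ N) {x y : ℝ} (hx : 0 < x) (hy : 0 < y) :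
    μ {ω | ∃ n ≤ N, x * (N : ℝ) ^ ((k : ℝ) / 2) <
        ‖uStat ξ (canonicalPart (μ.map (ξ 0)) g) n ω‖} ≤
      ENNReal.ofReal (3 * Real.exp (-(x / y) ^ (2 / (k : ℝ)))) +
        ∫⁻ u in Set.Ioi (1 : ℝ), μ {ω | 1 / (8 * 8 ^ k) * u * y < ‖g (initial ξ k ω)‖} *
          ENNReal.ofReal u := by
  have : IsProbabilityMeasure (μ.map (ξ 0)) := Measure.isProbabilityMeasure_map (hξ 0).aemeasurable
  set P := μ.map (ξ 0) with hP
  set z := (x / y) ^ (2 / (k : ℝ)) with hz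
  set J := ∫⁻ u in Set.Ioi (1 : ℝ), μ {ω | 1 / (8 * 8 ^ k) * u * y < ‖g (initial ξ k ω)‖} *
    ENNReal.ofReal u with hJ
  -- For z < 1 the exponential term exceeds 3/e > 1; this is where the factor 3 is needed.
  rcases lt_or_ge z 1 with hz1 | hz1
  · refine le_trans prob_le_one (le_trans ?_ le_self_add)
    rw [← ENNReal.ofReal_one]
    refine ENNReal.ofReal_le_ofReal ?_
    have h1 : Real.exp (-1) ≤ Real.exp (-z) := Real.exp_le_exp.2 (by linarith)
    have h2 : 1 / 3 ≤ Real.exp (-1) := by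
      rw [Real.exp_neg, ← one_div]
      exact one_div_le_one_div_of_le (Real.exp_pos 1) Real.exp_one_lt_three.le
    linarith
  -- Finiteness of `J` is what makes the unbounded piece square integrable.
  rcases eq_or_ne J ⊤ with hJtop | hJtop
  · rw [hJtop]; simp
  have hxy : y ≤ x := by
    by_contra hlt
    have : (x / y) ^ (2 / (k : ℝ)) < 1 :=
      Real.rpow_lt_one (by positivity) ((div_lt_one hy).2 (not_le.1 hlt))
        (by have : (0 : ℝ) < k := by exact_mod_cast hk
            positivity)
    linarith
  set M := 1 / (4 * 8 ^ k) * y with hM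
  have hM0 : 0 < M := by positivity
  set T := {s : Fin k → S | M < ‖g s‖} with hT
  have hTm : MeasurableSet T := measurableSet_lt measurable_const hgm.norm.measurable
  set g₁ := Tᶜ.indicator g with hg₁
  set g₂ := T.indicator g with hg₂
  have hg₁m : StronglyMeasurable g₁ := hgm.indicator hTm.compl
  have hg₂m : StronglyMeasurable g₂ := hgm.indicator hTm
  have hsum : (fun s => g₁ s + g₂ s) = g := by
    funext s
    exact Set.indicator_compl_add_self_apply T g s
  have hg₁b : ∀ s, ‖g₁ s‖ ≤ M := by
    intro s
    by_cases hs : s ∈ T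
    · simp [hg₁, hs, hM0.le]
    · simp only [hg₁, Set.indicator, Set.mem_compl_iff, hs, not_false_eq_true, if_true]
      exact not_lt.1 hs
  have hlt : ∫⁻ s, ENNReal.ofReal (‖g₂ s‖ ^ 2) ∂powMeasure P (Fin k) ≤ ENNReal.ofReal (M ^ 2) * J := by
    refine (lintegral_truncated_sq_le hgm hM0).trans (le_of_eq ?_)
    rw [hJ]
    congr 1
    refine lintegral_congr fun u => ?_
    congr 1
    have hms : MeasurableSet {s : Fin k → S | M / 2 * u < ‖g s‖} :=
      measurableSet_lt measurable_const hgm.norm.measurable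
    rw [← (measurePreserving_initial hξ hind hid k).measure_preimage hms.nullMeasurableSet]
    congr 1
    ext ω
    simp only [Set.mem_preimage, Set.mem_ofPred_eq, hM]
    rw [show 1 / (4 * 8 ^ k) * y / 2 * u = 1 / (8 * 8 ^ k) * u * y by field_simp; ring]
  have hsq : Integrable (fun s => ‖g₂ s‖ ^ 2) (powMeasure P (Fin k)) := by
    have hm : StronglyMeasurable fun s => ‖g₂ s‖ ^ 2 := hg₂m.norm.pow 2
    refine ⟨hm.aestronglyMeasurable, ?_⟩
    rw [hasFiniteIntegral_iff_ofReal (Filter.Eventually.of_forall fun s => by positivity)]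
    exact hlt.trans_lt (ENNReal.mul_lt_top ENNReal.ofReal_lt_top hJtop.lt_top)
  have hmem₂ : MemLp g₂ (2 * 1 : ℕ) (powMeasure P (Fin k)) :=
    (memLp_natCast_iff hg₂m.aestronglyMeasurable (by norm_num)).1 (by simpa using hsq)
  have hmem₁ : ∀ q : ℕ, MemLp g₁ (2 * q : ℕ) (powMeasure P (Fin k)) := fun q =>
    MemLp.of_bound hg₁m.aestronglyMeasurable M (Filter.Eventually.of_forall hg₁b)
  have hint₁ : Integrable g₁ (powMeasure P (Fin k)) := hg.indicator hTm.compl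
  have hint₂ : Integrable g₂ (powMeasure P (Fin k)) := hg.indicator hTm
  -- Each of the two pieces is allowed half of the level.
  set l := x / 2 * (N : ℝ) ^ ((k : ℝ) / 2) with hl
  have hN0 : (0 : ℝ) < N := by exact_mod_cast hN
  have hl0 : 0 < l := by positivity
  have hl2 : l ^ 2 = (x / 2) ^ 2 * N ^ k := by
    rw [hl, mul_pow]
    congr 1
    rw [← Real.rpow_natCast, ← Real.rpow_mul hN0.le, ← Real.rpow_natCast]
    congr 1
    push_cast
    ring
  -- the bounded part
  set q := ⌈z⌉₊ with hq
  have hq1 : 1 ≤ q := Nat.one_le_iff_ne_zero.2 (by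
    rw [hq]; exact (Nat.ceil_pos.2 (by linarith)).ne')
  have hqz : z ≤ q := Nat.le_ceil z
  have hq2 : (q : ℝ) ≤ 2 * z := by
    have := Nat.ceil_lt_add_one (show 0 ≤ z by linarith)
    linarith
  have hb₁ : μ {ω | ∃ n ≤ N, l ≤ ‖uStat ξ (canonicalPart P g₁) n ω‖} ≤
      ENNReal.ofReal (Real.exp (-z)) := by
    obtain ⟨hm, hle⟩ := integral_norm_canonicalPart_pow_le (by omega) hg₁m (hmem₁ q)
    refine (measure_exists_le_norm_uStat_le hξ hind hid hq1
      (stronglyMeasurable_canonicalPart hg₁m) hm (isCanonical_canonicalPart hg₁m hint₁) N hl0).trans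
      (ENNReal.ofReal_le_ofReal ?_)
    have hM1 : ∫ s, ‖g₁ s‖ ^ (2 * q) ∂powMeasure P (Fin k) ≤ M ^ (2 * q) := by
      refine (integral_mono ((memLp_natCast_iff (hmem₁ q).1 (by omega)).2 (hmem₁ q))
        (integrable_const (M ^ (2 * q))) fun s =>
          pow_le_pow_left₀ (norm_nonneg _) (hg₁b s) _).trans ?_
      simp
    -- The powers of N cancel against `l`, leaving the q-th power of a ratio at most 1/e; since q ≥
    -- z, this gives exp(-z).
    calc _ ≤ ((8 * q * N : ℝ) ^ k) ^ q * ((2 ^ k) ^ (2 * q) * M ^ (2 * q)) / l ^ (2 * q) := by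
          gcongr
          exact hle.trans (by gcongr)
      _ = ((8 * q : ℝ) ^ k * (2 ^ k) ^ 2 * M ^ 2 / (x / 2) ^ 2) ^ q := by
          rw [pow_mul l, hl2, pow_mul, pow_mul, ← mul_pow, ← mul_pow, ← div_pow]
          congr 1
          rw [mul_pow (8 * (q : ℝ)) (N : ℝ) k]
          field_simp
      _ ≤ Real.exp (-1) ^ q := by
          gcongr
          exact four_mul_pow_bound hk hx hy hq2
      _ = Real.exp (-q) := by rw [← Real.exp_nat_mul]; congr 1; ring
      _ ≤ Real.exp (-z) := Real.exp_le_exp.2 (by linarith)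
  -- the unbounded part
  have hb₂ : μ {ω | ∃ n ≤ N, l ≤ ‖uStat ξ (canonicalPart P g₂) n ω‖} ≤ J := by
    obtain ⟨hm, hle⟩ := integral_norm_canonicalPart_pow_le (by norm_num) hg₂m hmem₂
    refine (measure_exists_le_norm_uStat_le hξ hind hid le_rfl
      (stronglyMeasurable_canonicalPart hg₂m) hm (isCanonical_canonicalPart hg₂m hint₂) N hl0).trans ?_
    rw [mul_one] at hle
    have hI : ENNReal.ofReal (∫ s, ‖g₂ s‖ ^ 2 ∂powMeasure P (Fin k)) ≤
        ENNReal.ofReal (M ^ 2) * J := by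
      rw [ofReal_integral_eq_lintegral_ofReal hsq
        (Filter.Eventually.of_forall fun s => by positivity)]
      exact hlt
    -- The same numerical bound with q = 1, admissible because z ≥ 1; it cancels the factor M² of
    -- the truncated second moment.
    have hc : (8 : ℝ) ^ k * (2 ^ k) ^ 2 / (x / 2) ^ 2 * M ^ 2 ≤ 1 := by
      have h1 := four_mul_pow_bound hk hx hy (q := 1) (by push_cast; linarith)
      have h2 : Real.exp (-1) ≤ 1 := Real.exp_le_one_iff.2 (by norm_num)
      refine le_trans (le_of_eq ?_) (h1.trans h2)
      rw [hM]; push_cast; ring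
    calc _ ≤ ENNReal.ofReal ((8 : ℝ) ^ k * (2 ^ k) ^ 2 / (x / 2) ^ 2 *
            ∫ s, ‖g₂ s‖ ^ 2 ∂powMeasure P (Fin k)) := by
          refine ENNReal.ofReal_le_ofReal ?_
          calc _ ≤ (8 * N : ℝ) ^ k * ((2 ^ k) ^ 2 * ∫ s, ‖g₂ s‖ ^ 2 ∂powMeasure P (Fin k)) /
                  l ^ 2 := by
                simp only [Nat.cast_one, mul_one, pow_one]
                gcongr
            _ = _ := by
                rw [hl2, mul_pow]
                field_simp
      _ ≤ ENNReal.ofReal ((8 : ℝ) ^ k * (2 ^ k) ^ 2 / (x / 2) ^ 2) *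
            (ENNReal.ofReal (M ^ 2) * J) := by
          rw [ENNReal.ofReal_mul (by positivity)]
          gcongr
      _ = ENNReal.ofReal ((8 : ℝ) ^ k * (2 ^ k) ^ 2 / (x / 2) ^ 2 * M ^ 2) * J := by
          rw [← mul_assoc, ← ENNReal.ofReal_mul (by positivity)]
      _ ≤ 1 * J := by
          gcongr
          exact ENNReal.ofReal_le_one.2 hc
      _ = J := one_mul J
  have hae := ae_uStat_congr hξ hind hid (canonicalPart_add hint₁ hint₂)
  rw [hsum] at hae
  calc _ ≤ μ ({ω | ∃ n ≤ N, l ≤ ‖uStat ξ (canonicalPart P g₁) n ω‖} ∪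
          {ω | ∃ n ≤ N, l ≤ ‖uStat ξ (canonicalPart P g₂) n ω‖}) := by
        refine measure_mono_ae ?_
        filter_upwards [hae] with ω hω
        rintro ⟨n, hn, hlt⟩
        have e : uStat ξ (canonicalPart P g) n ω =
            uStat ξ (canonicalPart P g₁) n ω + uStat ξ (canonicalPart P g₂) n ω := by
          rw [hω n]
          exact Finset.sum_add_distrib
        by_contra hnot
        replace hnot : ¬((∃ n ≤ N, l ≤ ‖uStat ξ (canonicalPart P g₁) n ω‖) ∨
          ∃ n ≤ N, l ≤ ‖uStat ξ (canonicalPart P g₂) n ω‖) := hnot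
        simp only [not_or, not_exists, not_and, not_le] at hnot
        have h1 := hnot.1 n hn
        have h2 := hnot.2 n hn
        have h3 := norm_add_le (uStat ξ (canonicalPart P g₁) n ω) (uStat ξ (canonicalPart P g₂) n ω)
        rw [← e] at h3
        have h4 : l + l = x * (N : ℝ) ^ ((k : ℝ) / 2) := by rw [hl]; ring
        linarith
    _ ≤ _ := measure_union_le _ _
    _ ≤ ENNReal.ofReal (Real.exp (-z)) + J := add_le_add hb₁ hb₂
    _ ≤ _ := by
        gcongr
        linarith [Real.exp_pos (-z)]

end Tail
end UStat

namespace UStat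

/-! ### Reduction to canonical kernels and conclusion -/

section Main
variable {Ω S : Type*} [MeasurableSpace Ω] {μ : Measure Ω} [IsProbabilityMeasure μ]
  [MeasurableSpace S] {ξ : ℕ → Ω → S}
variable {H : Type*} [NormedAddCommGroup H] [InnerProductSpace ℝ H] [CompleteSpace H]

/-- Under degeneracy, the `U`-statistic is a combination of those of canonical kernels. -/
lemma ae_norm_uStat_le_sum (hξ : ∀ i, Measurable (ξ i)) (hind : iIndepFun ξ μ)
    (hid : ∀ i, IdentDistrib (ξ i) (ξ 0) μ μ) {m : ℕ} {h : (Fin m → S) → H}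
    (hhm : StronglyMeasurable h) (hh : Integrable h (powMeasure (μ.map (ξ 0)) (Fin m)))
    (hsymm : IsSymmetric h) {d : ℕ} (hdeg : IsDegenerateOfOrder μ ξ h d) :
    ∀ᵐ ω ∂μ, ∀ n, m ≤ n → ‖uStat ξ h n ω‖ ≤ ∑ k ∈ Finset.Icc d m, (n : ℝ) ^ (m - k) *
      ‖uStat ξ (canonicalPart (μ.map (ξ 0)) (partialMean (μ.map (ξ 0)) h k)) n ω‖ := by
  have : IsProbabilityMeasure (μ.map (ξ 0)) := Measure.isProbabilityMeasure_map (hξ 0).aemeasurable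
  have h1 : ∀ᵐ ω ∂μ, ∀ k ∈ Finset.range d, ∀ n, uStat ξ (hoeffdingKernel μ ξ h k) n ω = 0 :=
    (Finset.eventually_all _).2 fun k hk => ae_all_iff.2 fun n =>
      hdeg k (Finset.mem_range.1 hk) n
  have h2 : ∀ᵐ ω ∂μ, ∀ k ∈ Finset.range (m + 1), ∀ n, uStat ξ (hoeffdingKernel μ ξ h k) n ω =
      uStat ξ (canonicalPart (μ.map (ξ 0)) (partialMean (μ.map (ξ 0)) h k)) n ω := by
    refine (Finset.eventually_all _).2 fun k hk => ?_
    refine ae_uStat_congr hξ hind hid ?_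
    rw [hoeffdingKernel_eq_sum_partialMean hξ hind hid hhm]
    exact ae_sum_partialMean_eq_canonicalPart (Nat.lt_succ_iff.1 (Finset.mem_range.1 hk))
      hhm hsymm hh
  filter_upwards [h1, h2] with ω hω1 hω2 n hn
  have hdec := uStat_eq_sum_choose_smul hn (partialMean (μ.map (ξ 0)) h) ξ ω
  rw [partialMean_self] at hdec
  simp_rw [← hoeffdingKernel_eq_sum_partialMean hξ hind hid hhm] at hdec
  rw [hdec, ← Finset.sum_subset (s₁ := Finset.Icc d m)
    (fun k hk => Finset.mem_range.2 (Nat.lt_succ_iff.2 (Finset.mem_Icc.1 hk).2))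
    (fun k hk hk' => by
      have hkd : k < d := by
        have := Finset.mem_range.1 hk
        simp only [Finset.mem_Icc, not_and, not_le] at hk'
        by_contra hlt
        have := hk' (not_lt.1 hlt)
        omega
      rw [hω1 k (Finset.mem_range.2 hkd) n, smul_zero])]
  refine (norm_sum_le _ _).trans (Finset.sum_le_sum fun k hk => ?_)
  rw [hω2 k (Finset.mem_range.2 (Nat.lt_succ_iff.2 (Finset.mem_Icc.1 hk).2)) n, norm_smul]
  gcongr
  rw [Real.norm_of_nonneg (by positivity)]
  calc ((n - k).choose (m - k) : ℝ) ≤ (n - k : ℕ) ^ (m - k) := by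
        exact_mod_cast Nat.choose_le_pow _ _
    _ ≤ _ := by
        gcongr
        omega

omit [CompleteSpace H] in
lemma ae_norm_partialMean_le_condNorm (hξ : ∀ i, Measurable (ξ i))
    (hind : iIndepFun ξ μ) (hid : ∀ i, IdentDistrib (ξ i) (ξ 0) μ μ) {k m : ℕ} (hkm : k ≤ m)
    {h : (Fin m → S) → H} (hhm : StronglyMeasurable h)
    (hh : Integrable h (powMeasure (μ.map (ξ 0)) (Fin m))) :
    ∀ᵐ ω ∂μ, ‖partialMean (μ.map (ξ 0)) h k (initial ξ k ω)‖ ≤ condNorm μ ξ h k ω := by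
  filter_upwards [condNorm_ae_eq hξ hind hid hkm hhm hh] with ω hω
  rw [hω]
  exact norm_integral_le_integral_norm _

end Main

end UStat

theorem mainTheorem2 (m : ℕ) (hm : 1 ≤ m) :
    ∃ A B C : ℝ, 0 < A ∧ 0 < B ∧ 0 < C ∧
      ∀ (H : Type*) [NormedAddCommGroup H] [InnerProductSpace ℝ H] [CompleteSpace H]
        [SecondCountableTopology H] [MeasurableSpace H] [BorelSpace H]
        (S : Type*) [MeasurableSpace S]
        (Ω : Type*) [MeasurableSpace Ω] (μ : Measure Ω) [IsProbabilityMeasure μ]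
        (ξ : ℕ → Ω → S) (h : (Fin m → S) → H) (d : ℕ),
        (∀ i, Measurable (ξ i)) → iIndepFun ξ μ → (∀ i, IdentDistrib (ξ i) (ξ 0) μ μ) →
        Measurable h → Integrable (fun ω => h (UStat.initial ξ m ω)) μ →
        UStat.IsSymmetric h → 1 ≤ d → d ≤ m → UStat.IsDegenerateOfOrder μ ξ h d →
        ∀ (N : ℕ) (hN : m ≤ N) (x y : ℝ), 0 < x → 0 < y →
          μ {ω | x * (N : ℝ) ^ ((m : ℝ) - (d : ℝ) / 2) <
              (Finset.Icc m N).sup' (Finset.nonempty_Icc.2 hN) fun n => ‖UStat.uStat ξ h n ω‖}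
            ≤ ENNReal.ofReal (A * Real.exp (-(x / y) ^ (2 / (d : ℝ))))
              + ENNReal.ofReal B * ∑ k ∈ Finset.Icc d m, ∫⁻ u in Set.Ioi (1 : ℝ),
                  μ {ω | C * u * (N : ℝ) ^ (((k : ℝ) - (d : ℝ)) / 2)
                      * x ^ (1 - (k : ℝ) / (d : ℝ)) * y ^ ((k : ℝ) / (d : ℝ))
                        < UStat.condNorm μ ξ h k ω}
                    * ENNReal.ofReal (u * (1 + Real.log u) ^ ((m : ℝ) * ((m : ℝ) + 1) / 2)) := by
  have hm0 : (0 : ℝ) < m := by exact_mod_cast hm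
  -- At most m values of k contribute 3 each to A. In C, 8·8^m dominates the 8·8^k of the tail
  -- inequality, and m comes from `Y`.
  refine ⟨3 * m, 1, 1 / (8 * 8 ^ m * m), by positivity, one_pos, by positivity, ?_⟩
  intro H _ _ _ _ _ _ S _ Ω _ μ _ ξ h d hξ hind hid hhmeas hhint hsymm hd hdm hdeg N hN x y hx hy
  have hhm : StronglyMeasurable h := hhmeas.stronglyMeasurable
  have hprob : IsProbabilityMeasure (μ.map (ξ 0)) :=
    Measure.isProbabilityMeasure_map (hξ 0).aemeasurable
  have hh : Integrable h (UStat.powMeasure (μ.map (ξ 0)) (Fin m)) :=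
    ((UStat.measurePreserving_initial hξ hind hid m).integrable_comp
      hhm.aestronglyMeasurable).1 hhint
  have hN1 : 1 ≤ N := hm.trans hN
  have hN0 : (0 : ℝ) < N := by exact_mod_cast hN1
  have hd0 : (0 : ℝ) < d := by exact_mod_cast hd
  -- `X` is chosen so that the weight N^{m-k} turns the level X_k N^{k/2} into a 1/m share of x
  -- N^{m-d/2}; `Y` is chosen so that X_k/Y_k = (x/y)^{k/d}, giving the same exponential for every
  -- k.
  set X : ℕ → ℝ := fun k => x / m * (N : ℝ) ^ (((k : ℝ) - d) / 2) with hX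
  set Y : ℕ → ℝ := fun k => 1 / m * ((N : ℝ) ^ (((k : ℝ) - d) / 2) *
    x ^ (1 - (k : ℝ) / d) * y ^ ((k : ℝ) / d)) with hY
  have hX0 : ∀ k, 0 < X k := fun k => by positivity
  have hY0 : ∀ k, 0 < Y k := fun k => by positivity
  set U : ℕ → ℕ → Ω → ℝ := fun k n ω => ‖UStat.uStat ξ
    (UStat.canonicalPart (μ.map (ξ 0)) (UStat.partialMean (μ.map (ξ 0)) h k)) n ω‖ with hU
  have hXN : ∀ k ∈ Finset.Icc d m, (N : ℝ) ^ (m - k) * (X k * (N : ℝ) ^ ((k : ℝ) / 2)) =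
      x / m * (N : ℝ) ^ ((m : ℝ) - (d : ℝ) / 2) := by
    intro k hk
    have hkm := (Finset.mem_Icc.1 hk).2
    rw [hX, ← Real.rpow_natCast, Nat.cast_sub hkm]
    calc _ = x / m * ((N : ℝ) ^ ((m : ℝ) - k) * (N : ℝ) ^ (((k : ℝ) - d) / 2) *
          (N : ℝ) ^ ((k : ℝ) / 2)) := by ring
      _ = _ := by
        rw [← Real.rpow_add hN0, ← Real.rpow_add hN0]
        congr 2
        ring
  have hz : ∀ k, 1 ≤ k → (X k / Y k) ^ (2 / (k : ℝ)) = (x / y) ^ (2 / (d : ℝ)) := by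
    intro k hk
    have hk0 : (0 : ℝ) < k := by exact_mod_cast hk
    have e : X k / Y k = (x / y) ^ ((k : ℝ) / d) := by
      rw [Real.div_rpow hx.le hy.le, hX, hY]
      simp only
      rw [Real.rpow_sub hx, Real.rpow_one]
      have := (Real.rpow_pos_of_pos hN0 (((k : ℝ) - d) / 2)).ne'
      have := (Real.rpow_pos_of_pos hx ((k : ℝ) / d)).ne'
      have := (Real.rpow_pos_of_pos hy ((k : ℝ) / d)).ne'
      field_simp
    rw [e, ← Real.rpow_mul (by positivity)]
    congr 1
    field_simp
  have htail : ∀ k ∈ Finset.Icc d m,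
      μ {ω | ∃ n ≤ N, X k * (N : ℝ) ^ ((k : ℝ) / 2) < U k n ω} ≤
        ENNReal.ofReal (3 * Real.exp (-(x / y) ^ (2 / (d : ℝ)))) +
        ∫⁻ u in Set.Ioi (1 : ℝ),
          μ {ω | 1 / (8 * 8 ^ m * m) * u * (N : ℝ) ^ (((k : ℝ) - (d : ℝ)) / 2)
              * x ^ (1 - (k : ℝ) / (d : ℝ)) * y ^ ((k : ℝ) / (d : ℝ))
                < UStat.condNorm μ ξ h k ω}
            * ENNReal.ofReal (u * (1 + Real.log u) ^ ((m : ℝ) * ((m : ℝ) + 1) / 2)) := by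
    intro k hk
    obtain ⟨hdk, hkm⟩ := Finset.mem_Icc.1 hk
    have hk1 : 1 ≤ k := hd.trans hdk
    refine (UStat.measure_uStat_canonicalPart_le hξ hind hid hk1
      (UStat.stronglyMeasurable_partialMean hhm k) (UStat.integrable_partialMean hh k) hN1
      (hX0 k) (hY0 k)).trans ?_
    rw [hz k hk1]
    refine add_le_add le_rfl ?_
    refine setLIntegral_mono' measurableSet_Ioi fun u hu => ?_
    have hu1 : 1 < u := hu
    refine mul_le_mul' (measure_mono_ae ?_) (ENNReal.ofReal_le_ofReal ?_)
    · filter_upwards [UStat.ae_norm_partialMean_le_condNorm hξ hind hid hkm hhm hh] with ω hω hlt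
      refine lt_of_le_of_lt ?_ (lt_of_lt_of_le hlt hω)
      have h8 : (8 : ℝ) ^ k ≤ 8 ^ m := pow_le_pow_right₀ (by norm_num) hkm
      have hu0 : 0 < u := by linarith
      calc _ = 1 / (8 * 8 ^ m) * u * Y k := by
            rw [hY]; field_simp
        _ ≤ 1 / (8 * 8 ^ k) * u * Y k := by
            have := (hY0 k).le
            gcongr
    -- For u > 1 the logarithmic weight is at least 1, so inserting it only enlarges the integral.
    · have hlog := Real.log_nonneg hu1.le
      refine le_mul_of_one_le_right (by linarith) (Real.one_le_rpow (by linarith) (by positivity))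
  have hcard : (Finset.Icc d m).card ≤ m := by rw [Nat.card_Icc]; omega
  calc _ ≤ μ (⋃ k ∈ Finset.Icc d m, {ω | ∃ n ≤ N, X k * (N : ℝ) ^ ((k : ℝ) / 2) < U k n ω}) := by
        refine measure_mono_ae ?_
        filter_upwards [UStat.ae_norm_uStat_le_sum hξ hind hid hhm hh hsymm hdeg] with ω hω hlt
        obtain ⟨n, hn, hlt⟩ := (Finset.lt_sup'_iff _).1 hlt
        obtain ⟨hmn, hnN⟩ := Finset.mem_Icc.1 hn
        -- If no order exceeds its level, the sum of at most m shares x/m stays within the total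
        -- level.
        by_contra hnot
        have hle : ∀ k ∈ Finset.Icc d m, U k n ω ≤ X k * (N : ℝ) ^ ((k : ℝ) / 2) := by
          intro k hk
          by_contra hgt
          exact hnot (Set.mem_biUnion hk ⟨n, hnN, not_le.1 hgt⟩)
        refine absurd (hω n hmn) (not_le.2 (lt_of_le_of_lt ?_ hlt))
        calc _ ≤ ∑ k ∈ Finset.Icc d m, x / m * (N : ℝ) ^ ((m : ℝ) - (d : ℝ) / 2) := by
              refine Finset.sum_le_sum fun k hk => ?_
              rw [← hXN k hk]
              have := hle k hk
              gcongr
          _ = (Finset.Icc d m).card * (x / m * (N : ℝ) ^ ((m : ℝ) - (d : ℝ) / 2)) := by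
              rw [Finset.sum_const, nsmul_eq_mul]
          _ ≤ m * (x / m * (N : ℝ) ^ ((m : ℝ) - (d : ℝ) / 2)) := by gcongr
          _ = _ := by field_simp
    _ ≤ ∑ k ∈ Finset.Icc d m, μ {ω | ∃ n ≤ N, X k * (N : ℝ) ^ ((k : ℝ) / 2) < U k n ω} :=
        measure_biUnion_finset_le _ _
    _ ≤ _ := Finset.sum_le_sum htail
    _ ≤ _ := by
        rw [Finset.sum_add_distrib, Finset.sum_const, ENNReal.ofReal_one, one_mul]
        refine add_le_add ?_ le_rfl
        rw [← ENNReal.ofReal_nsmul, nsmul_eq_mul]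
        refine ENNReal.ofReal_le_ofReal ?_
        calc _ ≤ (m : ℝ) * (3 * Real.exp (-(x / y) ^ (2 / (d : ℝ)))) := by gcongr
          _ = _ := by ring
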